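/- Let $k\ge 2$, let $h:\mathbb N\to\mathbb Q_{\ge 0}$ be a $k$-automatic sequence (some finite automaton with output computes $h(n)$ by reading the base-$k$ expansion $(n)_k$ of $n$ from the most significant digit on, where $(0)_k$ is the empty word), and let $s(n)=\sum_{j<n}h(j)$. Then $\limsup_{n\to\infty}s(n)/n$ is a rational number, and it is recursively computable: there is one algorithm that, given $k\ge2$ and any deterministic finite automaton with output in $\mathbb Q_{\ge0}$ (DFAO) over the alphabet $\Sigma_k=\{0,\dots,k-1\}$, returns a numerator and a nonzero denominator of $\limsup s(n)/n$ for the sequence $h$ generated by it. Moreover, the limsup is the following maximum. For a word $w\in\Sigma_k^*$ let $|w|$ be its length, $[w]_k$ the number it represents in base $k$ (leading zeros allowed), and $f(w)=h([w]_k)$. For $u\in\Sigma_k^*$ let $f_u$ be the map $w\mapsto f(uw)$. The set $\{f_u : u\in\Sigma_k^*\}$ is finite; let $d$ be its cardinality. For $a=\operatorname{lcm}(1,\dots,d)$ the limits $$c_{g,j}=\lim_{n\to\infty}k^{-(an+j)}\sum_{|w|=an+j}g(w)\qquad(g\in\{f_u\},\ 0\le j<a)$$ exist and are rational. For every $a\ge1$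 for which all these limits exist and are rational, $\limsup_{n\to\infty} s(n)/n$ is the maximum of the finitely many numbers $$\frac{\kappa_{A}+\kappa'_{B}/(k^{|B|}-1)}{[A]_k+[B]_k/(k^{|B|}-1)},\qquad \kappa_{A}=\sum_{|v|=|A|,\,v\prec A}c_{f_v,j},\qquad \kappa'_{B}=\sum_{|v|=|B|,\,v\prec B}c_{f_{Av},j},$$ where $\prec$ is the lexicographic order, $j$ runs over $0,\dots,a-1$, and $(A,B)$ runs over all pairs of nonempty words in $\Sigma_k^*$ whose lengths are multiples of $a$, such that $A$ does not begin with $0$, $f_{AB}=f_A$, and $|A|+|B|\le(2d+1)a$. -/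

import Mathlib

open Filter Topology

/-- The value `[w]_k` of a word over `{0, …, k-1}`, most significant digit first; leading zeros are
allowed and the empty word has value `0`. -/
def wordVal {k : ℕ} (w : List (Fin k)) : ℕ :=
  Nat.ofDigits k (w.map Fin.val).reverse

/-- The base-`k` expansion `(n)_k`, most significant digit first, without leading zeros; `(0)_k` is
the empty word. -/
def baseRep (k : ℕ) (hk : 2 ≤ k) (n : ℕ) : List (Fin k) :=
  (Nat.digits k n).reverse.pmap Fin.mk
    (fun _ hd => Nat.digits_lt_base hk (List.mem_reverse.mp hd))

/-- A deterministic automaton with output, with alphabet `α`, state set `Q` and output alphabet `Δ`.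
Finiteness of `α` and `Q` is guaranteed where it is used: `α = Fin k`, `Q = Fin m`. -/
structure DFAO (α Q Δ : Type) where
  step : Q → α → Q
  start : Q
  out : Q → Δ

/-- The output on a word, which is read from left to right. -/
def DFAO.output {α Q Δ : Type} (Γ : DFAO α Q Δ) (w : List α) : Δ :=
  Γ.out (w.foldl Γ.step Γ.start)

/-- The automaton computes `h n` from the base-`k` expansion of `n`, for every `n`. -/
def DFAO.Generates {k : ℕ} {Q Δ : Type} (hk : 2 ≤ k) (Γ : DFAO (Fin k) Q Δ) (h : ℕ → Δ) : Prop :=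
  ∀ n, h n = Γ.output (baseRep k hk n)

/-- `k`-automatic sequences. Up to renaming, the finite state set is `Fin m`. -/
def IsAutomatic {k : ℕ} (hk : 2 ≤ k) {Δ : Type} (h : ℕ → Δ) : Prop :=
  ∃ (m : ℕ) (Γ : DFAO (Fin k) (Fin m) Δ), Γ.Generates hk h

/-- The partial sums `s(n) = ∑_{j < n} h(j)`. -/
def partialSum (h : ℕ → ℚ≥0) (n : ℕ) : ℚ≥0 :=
  ∑ j ∈ Finset.range n, h j

/-- The upper mean `limsup s(n)/n`. (If `h` has finite range, as every automatic sequence does, then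
`s(n)/n` is bounded, so this is the limsup in the usual sense.) -/
noncomputable def upperMean (h : ℕ → ℚ≥0) : ℝ :=
  limsup (fun n : ℕ => (partialSum h n : ℝ) / (n : ℝ)) atTop

/-- The sequence `h` seen as a map on words: `f(w) = h([w]_k)`, so that `f(0w) = f(w)`. -/
def wordMap (k : ℕ) {Δ : Type} (h : ℕ → Δ) (w : List (Fin k)) : Δ :=
  h (wordVal w)

/-- The map `w ↦ g(uw)`. -/
def leftShift {α Δ : Type} (g : List α → Δ) (u : List α) : List α → Δ :=
  fun w => g (u ++ w)

/-- The left `k`-kernel of `h`: all maps `w ↦ f(uw)`, where `u` is a word and `f(w) = h([w]_k)`. -/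
def leftKernel (k : ℕ) {Δ : Type} (h : ℕ → Δ) : Set (List (Fin k) → Δ) :=
  Set.range (leftShift (wordMap k h))

/-- The sum of `g(w)` over all words `w` of length `m`. -/
def wordSum {k : ℕ} (g : List (Fin k) → ℚ≥0) (m : ℕ) : ℚ≥0 :=
  ∑ v : Fin m → Fin k, g (List.ofFn v)

/-- For each `g` in the left kernel and each `j < a`, the mean of `g` over the words of length
`a * n + j` tends to `c g j` as `n → ∞`. -/
def IsMeanSystem (k : ℕ) (h : ℕ → ℚ≥0) (a : ℕ)
    (c : (List (Fin k) → ℚ≥0) → ℕ → ℚ) : Prop :=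
  ∀ g ∈ leftKernel k h, ∀ j < a,
    Tendsto (fun n : ℕ => (wordSum g (a * n + j) : ℝ) / (k : ℝ) ^ (a * n + j)) atTop
      (𝓝 (c g j : ℝ))

/-- The sum of the constants `c_{g(v ·), j}` over the words `v` of the same length as `A` that
precede `A` in the lexicographic order. -/
def kappa {k : ℕ} (c : (List (Fin k) → ℚ≥0) → ℕ → ℚ) (g : List (Fin k) → ℚ≥0)
    (A : List (Fin k)) (j : ℕ) : ℚ :=
  ∑ v : Fin A.length → Fin k with List.ofFn v < A, c (leftShift g (List.ofFn v)) j

/-- The pumping expression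
`(κ_A + κ'_B / (k^|B| - 1)) / ([A]_k + [B]_k / (k^|B| - 1))`. -/
def pumpValue (k : ℕ) (h : ℕ → ℚ≥0) (c : (List (Fin k) → ℚ≥0) → ℕ → ℚ)
    (A B : List (Fin k)) (j : ℕ) : ℚ :=
  (kappa c (wordMap k h) A j
      + kappa c (leftShift (wordMap k h) A) B j / ((k : ℚ) ^ B.length - 1))
    / ((wordVal A : ℚ) + (wordVal B : ℚ) / ((k : ℚ) ^ B.length - 1))

/-- The pairs of words `(A, B)` that are admitted in the maximum: both are nonempty with lengths
divisible by `a`, `A` has no leading zero, `|A| + |B| ≤ (2d+1)a` where `d` is the size of the left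
kernel, and appending `B` to `A` does not change the element of the kernel that is reached. -/
def IsPumpPair (k : ℕ) (h : ℕ → ℚ≥0) (a : ℕ) (A B : List (Fin k)) : Prop :=
  A ≠ [] ∧ B ≠ [] ∧ (∀ x ∈ A.head?, x.val ≠ 0) ∧ a ∣ A.length ∧ a ∣ B.length ∧
    A.length + B.length ≤ (2 * (leftKernel k h).ncard + 1) * a ∧
    leftShift (wordMap k h) (A ++ B) = leftShift (wordMap k h) A

/-- All values of the pumping expression. -/
def pumpValues (k : ℕ) (h : ℕ → ℚ≥0) (a : ℕ) (c : (List (Fin k) → ℚ≥0) → ℕ → ℚ) : Set ℚ :=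
  {α | ∃ (A B : List (Fin k)) (j : ℕ), IsPumpPair k h a A B ∧ j < a ∧ α = pumpValue k h c A B j}

/-- Finite data that describe an automaton with output in `ℚ≥0`: base, number of states, initial
state, transition table (one row for each state), and the outputs as pairs
(numerator, denominator). -/
abbrev DFAOCode : Type := ℕ × ℕ × ℕ × List (List ℕ) × List (ℕ × ℕ)

/-- The description of an automaton with states `0, …, m-1` over the alphabet `{0, …, k-1}`. -/
def DFAO.code {k m : ℕ} (Γ : DFAO (Fin k) (Fin m) ℚ≥0) : DFAOCode :=
  (k, m, Γ.start.val,
    List.ofFn fun q : Fin m => List.ofFn fun i : Fin k => (Γ.step q i).val,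
    List.ofFn fun q : Fin m => ((Γ.out q).num, (Γ.out q).den))

/-! Let `T` be the operator that averages a function on the states over the `k` outgoing letters.
The mean of the output over the words of length `n` read from a state is the value of `T ^ n`
(output) there. `T` does not increase the sup norm, so its eigenvalues of modulus one are
semisimple, and the maximum principle makes them roots of unity of order at most the number of
states (`transfer_eigenvalue_pow`). Hence `T ^ (a n)` converges once `a` is divisible by all these
orders. The limit is the projection onto `ker (T ^ a - 1)` along `range (T ^ a - 1)`, which is
defined over `ℚ` (`exists_decomposition`); so the means are rational.

The partial sum up to a number with digits `w` followed by `n` zeros is a sum of block sums, one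
group for each digit of `w` (`partialSum_eq_lexSum`). Up to `o(k ^ n)` the block sums are the
weights `W q n = k ^ n c q (n mod a)`. For fixed `γ`, the quantity `s(N) - γ N` is then the total
reward of a deterministic decision process in which the digits of `N` are chosen one by one; lower
digits weigh less, so the process is discounted by `1 / k` and its Bellman equation has a solution
`V` (`exists_bellman`). If the best nonzero first digit has optimal value zero, then the limsup is
`γ` (`upperMean_eq_of_bellman`). An optimal digit sequence of length `(d + 1) a` visits some state
twice at multiples of `a`, and the loop equation then gives it the same value as `A B B B …`, whose
ratio is the pumping expression. So the largest pumping value is the right `γ`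
(`first_letter_le_of_loopPair`, `first_letter_ge_of_loopPair`).

For computability, the means, a coboundary witnessing them, `γ` and `V` are all rational. Finitely
many equations and inequalities between them determine the limsup (`IsCertificate.upperMean_eq`).
With denominators cleared, these conditions are primitive recursive, and a solution always exists
(`exists_isCertificate`), so an unbounded search terminates. -/

/-! ### Spectrum and convergence of the averaging operator -/

/-- The averaging operator `f ↦ (q ↦ k⁻¹ ∑ i, f (δ q i))` of a transition function. -/
def transfer (K : Type*) [Field K] {Q : Type*} {k : ℕ} (δ : Q → Fin k → Q) :
    (Q → K) →ₗ[K] (Q → K) where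
  toFun f q := (k : K)⁻¹ * ∑ i, f (δ q i)
  map_add' f g := by
    ext q
    simp [Finset.sum_add_distrib, mul_add]
  map_smul' c f := by
    ext q
    simp only [Pi.smul_apply, smul_eq_mul, ← Finset.mul_sum, RingHom.id_apply]
    ring

theorem transfer_apply (K : Type*) [Field K] {Q : Type*} {k : ℕ} (δ : Q → Fin k → Q)
    (f : Q → K) (q : Q) : transfer K δ f q = (k : K)⁻¹ * ∑ i, f (δ q i) := rfl

theorem transfer_pow_map {K L : Type*} [Field K] [Field L] (σ : K →+* L) {Q : Type*} {k : ℕ}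
    (δ : Q → Fin k → Q) (n : ℕ) (f : Q → K) (q : Q) :
    σ ((transfer K δ ^ n) f q) = (transfer L δ ^ n) (fun x => σ (f x)) q := by
  induction n generalizing q with
  | zero => simp
  | succ n ih => simp [pow_succ', transfer_apply, ih]

theorem norm_transfer_le {Q : Type*} [Fintype Q] {k : ℕ} (δ : Q → Fin k → Q) (f : Q → ℂ) :
    ‖transfer ℂ δ f‖ ≤ ‖f‖ := by
  refine (pi_norm_le_iff_of_nonneg (norm_nonneg _)).2 fun q => ?_
  rw [transfer_apply, norm_mul, norm_inv, Complex.norm_natCast]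
  have h : ‖∑ i, f (δ q i)‖ ≤ k * ‖f‖ :=
    (norm_sum_le_of_le _ fun i _ => norm_le_pi_norm f (δ q i)).trans (by simp)
  rcases Nat.eq_zero_or_pos k with rfl | hk
  · simp
  · rw [inv_mul_le_iff₀ (by positivity)]
    exact h

theorem norm_transfer_pow_le {Q : Type*} [Fintype Q] {k : ℕ} (δ : Q → Fin k → Q) (n : ℕ)
    (f : Q → ℂ) : ‖(transfer ℂ δ ^ n) f‖ ≤ ‖f‖ := by
  induction n with
  | zero => simp
  | succ n ih =>
    rw [pow_succ', Module.End.mul_apply]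
    exact (norm_transfer_le δ _).trans ih

/-- Equality case of the triangle inequality: expanding the squares bounds `∑ ‖z i - w‖ ^ 2` by an
expression in which `∑ z i` can be inserted, and it vanishes. -/
theorem eq_of_sum_eq_of_norm_le {ι : Type*} [Fintype ι] (z : ι → ℂ) (w : ℂ)
    (hs : ∑ i, z i = Fintype.card ι * w) (hz : ∀ i, ‖z i‖ ≤ ‖w‖) (i : ι) : z i = w := by
  have key : ∑ i, ‖z i - w‖ ^ 2 ≤ 0 := by
    have h1 : ∀ i, ‖z i - w‖ ^ 2 ≤ 2 * ‖w‖ ^ 2 - 2 * (z i * (starRingEnd ℂ) w).re := by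
      intro i
      have := pow_le_pow_left₀ (norm_nonneg _) (hz i) 2
      rw [← Complex.normSq_eq_norm_sq, Complex.normSq_sub, Complex.normSq_eq_norm_sq,
        Complex.normSq_eq_norm_sq]
      linarith
    refine (Finset.sum_le_sum fun i _ => h1 i).trans (le_of_eq ?_)
    rw [Finset.sum_sub_distrib, ← Finset.mul_sum, ← Finset.mul_sum, ← Complex.re_sum, ← Finset.sum_mul, hs, mul_assoc,
      Complex.mul_conj, Complex.normSq_eq_norm_sq]
    rw [← Complex.ofReal_natCast, ← Complex.ofReal_mul, Complex.ofReal_re]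
    simp
  have h2 := (Finset.sum_eq_zero_iff_of_nonneg fun i _ => by positivity).1
    (le_antisymm key (Finset.sum_nonneg fun i _ => by positivity)) i (Finset.mem_univ i)
  exact sub_eq_zero.1 (norm_eq_zero.1 (pow_eq_zero_iff (two_ne_zero)|>.1 h2))

/-- An eigenvalue of modulus one of the averaging operator is a root of unity whose order is at most
the number of states. -/
theorem transfer_eigenvalue_pow {Q : Type*} [Fintype Q] {k : ℕ} (hk : 0 < k) (δ : Q → Fin k → Q)
    {μ : ℂ} (hμ : ‖μ‖ = 1) {v : Q → ℂ} (hv : v ≠ 0) (h : transfer ℂ δ v = μ • v) {a : ℕ}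
    (ha : ∀ i, 1 ≤ i → i ≤ Fintype.card Q → i ∣ a) : μ ^ a = 1 := by
  have hne : Nonempty Q := by
    by_contra hq
    rw [not_nonempty_iff] at hq
    exact hv (Subsingleton.elim _ _)
  -- Maximum principle: where `‖v‖` is maximal, the average of the successors is `μ` times the
  -- value, so every successor takes exactly that value and is again maximal.
  obtain ⟨q₀, hq₀⟩ := Finite.exists_max fun q => ‖v q‖
  have hpos : v q₀ ≠ 0 := by
    intro h0
    refine hv (funext fun q => ?_)
    have := hq₀ q
    simpa [h0] using this
  let z : Fin k := ⟨0, hk⟩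
  let path : ℕ → Q := fun n => (fun q => δ q z)^[n] q₀
  have hpath : ∀ n, v (path n) = μ ^ n * v q₀ := by
    intro n
    induction n with
    | zero => simp [path]
    | succ n ih =>
      have hp : path (n + 1) = δ (path n) z := by
        simp only [path, Function.iterate_succ_apply']
      rw [hp]
      have e := congrFun h (path n)
      rw [transfer_apply, Pi.smul_apply, smul_eq_mul] at e
      have hk' : (k : ℂ) ≠ 0 := by exact_mod_cast hk.ne'
      rw [inv_mul_eq_iff_eq_mul₀ hk'] at e
      have := eq_of_sum_eq_of_norm_le (fun i => v (δ (path n) i)) (μ * v (path n))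
        (by simpa using e) (fun i => by
          rw [ih, norm_mul, norm_mul, norm_pow, hμ]
          simpa using hq₀ _) z
      rw [this, ih]
      ring
  -- Two of the first `card Q + 1` states of the path coincide; the distance between them bounds the
  -- order of `μ`.
  obtain ⟨s, t, hst, he⟩ := Fintype.exists_ne_map_eq_of_card_lt
    (fun i : Fin (Fintype.card Q + 1) => path i) (by simp)
  wlog hlt : s < t generalizing s t
  · exact this t s hst.symm he.symm (lt_of_le_of_ne (not_lt.1 hlt) hst.symm)
  have e2 : μ ^ (s : ℕ) * v q₀ = μ ^ (t : ℕ) * v q₀ := by rw [← hpath, ← hpath, he]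
  have e3 := mul_right_cancel₀ hpos e2
  have hμ0 : μ ≠ 0 := by
    rintro rfl
    simp at hμ
  have hlt' : (s : ℕ) < t := hlt
  have e4 : μ ^ ((t : ℕ) - s) = 1 := by
    have : μ ^ (s : ℕ) * μ ^ ((t : ℕ) - s) = μ ^ (s : ℕ) * 1 := by
      rw [← pow_add, Nat.add_sub_cancel' hlt'.le, mul_one, e3]
    exact mul_left_cancel₀ (pow_ne_zero _ hμ0) this
  obtain ⟨b, rfl⟩ := ha ((t : ℕ) - s) (by omega) (by have := t.2; omega)
  rw [pow_mul, e4, one_pow]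

/-- The threshold `ε / 2 * (1 - ‖μ‖)` for `e` makes `ε / 2` a fixed point of the recursion for the
norms; what remains of the initial bound decays geometrically. -/
theorem tendsto_zero_of_contracting_recurrence {E : Type*} [SeminormedAddCommGroup E] [NormedSpace ℂ E]
    {μ : ℂ} (hμ : ‖μ‖ < 1) {x e : ℕ → E} (hx : ∀ n, x (n + 1) = μ • x n + e n)
    (he : Tendsto e atTop (𝓝 0)) (hb : ∃ C, ∀ n, ‖x n‖ ≤ C) : Tendsto x atTop (𝓝 0) := by
  obtain ⟨C, hC⟩ := hb
  have hC0 : 0 ≤ C := (norm_nonneg _).trans (hC 0)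
  rw [tendsto_zero_iff_norm_tendsto_zero] at he ⊢
  rw [Metric.tendsto_atTop] at he ⊢
  intro ε hε
  obtain ⟨N, hN⟩ := he (ε / 2 * (1 - ‖μ‖)) (by have := sub_pos.2 hμ; positivity)
  have h1 : ∀ n, ‖x (N + n)‖ ≤ ε / 2 + ‖μ‖ ^ n * C := by
    intro n
    induction n with
    | zero =>
      have := hC N
      simp only [add_zero, pow_zero, one_mul]
      linarith
    | succ n ih =>
      rw [← add_assoc, hx]
      have h2 := hN (N + n) (by omega)
      simp only [dist_zero_right, norm_norm] at h2
      calc ‖μ • x (N + n) + e (N + n)‖ ≤ ‖μ‖ * ‖x (N + n)‖ + ‖e (N + n)‖ :=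
            (norm_add_le _ _).trans (by rw [norm_smul])
        _ ≤ ‖μ‖ * (ε / 2 + ‖μ‖ ^ n * C) + ε / 2 * (1 - ‖μ‖) := by gcongr
        _ = ε / 2 + ‖μ‖ ^ (n + 1) * C := by ring
  have h3 : Tendsto (fun n => ‖μ‖ ^ n * C) atTop (𝓝 (0 * C)) :=
    (tendsto_pow_atTop_nhds_zero_of_lt_one (norm_nonneg _) hμ).mul_const C
  rw [zero_mul] at h3
  obtain ⟨M, hM⟩ := eventually_atTop.1 (h3.eventually_lt_const (half_pos hε))
  refine ⟨N + M, fun n hn => ?_⟩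
  obtain ⟨t, rfl⟩ := Nat.exists_eq_add_of_le (show N ≤ n by omega)
  have h4 := h1 t
  have h5 := hM t (by omega)
  simp only [dist_zero_right, norm_norm]
  linarith

/-- The powers of a power bounded operator tend to zero on a generalized eigenvector whose eigenvalue
has modulus below one. -/
theorem tendsto_pow_apply_of_genEigenvector {E : Type*} [SeminormedAddCommGroup E] [NormedSpace ℂ E]
    {T : Module.End ℂ E} (hT : ∀ n v, ‖(T ^ n) v‖ ≤ ‖v‖) {μ : ℂ} (hμ : ‖μ‖ < 1) (r : ℕ) (v : E)
    (hv : ((T - μ • 1) ^ r) v = 0) : Tendsto (fun n => (T ^ n) v) atTop (𝓝 0) := by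
  induction r generalizing v with
  | zero =>
    obtain rfl : v = 0 := by simpa using hv
    simpa using tendsto_const_nhds
  | succ r ih =>
    rw [pow_succ, Module.End.mul_apply] at hv
    -- `T ^ n v` obeys a recursion with factor `μ` whose perturbation is the orbit of `(T - μ) v`, a
    -- generalized eigenvector of lower rank.
    refine tendsto_zero_of_contracting_recurrence hμ (e := fun n => (T ^ n) ((T - μ • 1) v))
      (fun n => ?_) (ih _ hv) ⟨‖v‖, fun n => hT n v⟩
    simp [pow_succ]

theorem eq_zero_of_norm_bounded_smul {E : Type*} [NormedAddCommGroup E] [NormedSpace ℂ E]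
    {u w : E} (C : ℝ) (h : ∀ n : ℕ, ∃ z : ℂ, ‖z‖ = 1 ∧ ‖z • w + (n : ℂ) • u‖ ≤ C) : u = 0 := by
  by_contra hu
  have hu' : 0 < ‖u‖ := norm_pos_iff.2 hu
  obtain ⟨n, hn⟩ := exists_nat_gt ((C + ‖w‖) / ‖u‖)
  rw [div_lt_iff₀ hu'] at hn
  obtain ⟨z, hz, h2⟩ := h n
  have h3 : ‖(n : ℂ) • u‖ ≤ ‖z • w + (n : ℂ) • u‖ + ‖z • w‖ := by
    have := norm_sub_le (z • w + (n : ℂ) • u) (z • w)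
    simpa using this
  rw [norm_smul, norm_smul, hz, Complex.norm_natCast] at h3
  linarith

/-- A generalized eigenvector of a power bounded operator is an eigenvector if the eigenvalue has
modulus one. -/
theorem eigenvector_of_genEigenvector {E : Type*} [NormedAddCommGroup E] [NormedSpace ℂ E]
    {T : Module.End ℂ E} (hT : ∀ n v, ‖(T ^ n) v‖ ≤ ‖v‖) {μ : ℂ} (hμ : ‖μ‖ = 1) (r : ℕ) (v : E)
    (hv : ((T - μ • 1) ^ r) v = 0) : T v = μ • v := by
  induction r generalizing v with
  | zero =>
    obtain rfl : v = 0 := by simpa using hv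
    simp
  | succ r ih =>
    rw [pow_succ, Module.End.mul_apply] at hv
    have hu := ih _ hv
    set u := (T - μ • 1) v with hu_def
    have hTv : T v = μ • v + u := by simp [hu_def]
    have hμ0 : μ ≠ 0 := by
      rintro rfl
      simp at hμ
    -- A nontrivial Jordan block would make the orbit grow linearly, against power boundedness.
    have hpow : ∀ n : ℕ, (T ^ n) v = μ ^ n • (v + ((n : ℂ) * μ⁻¹) • u) := by
      intro n
      induction n with
      | zero => simp
      | succ n ihn =>
        rw [pow_succ', Module.End.mul_apply, ihn, map_smul, map_add, map_smul, hu, hTv]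
        push_cast
        have : μ ^ n • u = (μ ^ (n + 1) * μ⁻¹) • u := by
          congr 1
          field_simp
          ring
        simp only [smul_add, smul_smul, this]
        rw [add_assoc, ← add_smul]
        congr 2
        ring_nf
    have hz : μ⁻¹ • u = 0 := by
      refine eq_zero_of_norm_bounded_smul (w := v) ‖v‖ fun n => ⟨1, by simp, ?_⟩
      have := hT n v
      rw [hpow, norm_smul, norm_pow, hμ, one_pow, one_mul] at this
      rw [one_smul, smul_smul]
      exact this
    have : u = 0 := by simpa [hμ0] using hz
    rw [hTv, this, add_zero]

/-- If all numbers up to the number of states divide `a`, then the powers of the `a`-th power of the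
averaging operator converge. -/
theorem exists_tendsto_transfer_pow {Q : Type*} [Fintype Q] {k : ℕ} (hk : 0 < k)
    (δ : Q → Fin k → Q) {a : ℕ} (ha0 : 0 < a) (ha : ∀ i, 1 ≤ i → i ≤ Fintype.card Q → i ∣ a)
    (v : Q → ℂ) : ∃ p, Tendsto (fun n => (transfer ℂ δ ^ (a * n)) v) atTop (𝓝 p) := by
  have hT := norm_transfer_pow_le δ
  have hmem : v ∈ (⊤ : Submodule ℂ (Q → ℂ)) := trivial
  -- Over `ℂ` the generalized eigenvectors span, so convergence is checked on each of them, by the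
  -- size of its eigenvalue.
  rw [← Module.End.iSup_maxGenEigenspace_eq_top (transfer ℂ δ)] at hmem
  induction hmem using Submodule.iSup_induction' with
  | zero => exact ⟨0, by simp⟩
  | add x y _ _ hx hy =>
    obtain ⟨p, hp⟩ := hx
    obtain ⟨p', hp'⟩ := hy
    exact ⟨p + p', by simpa using hp.add hp'⟩
  | mem μ x hx =>
    rw [Module.End.mem_maxGenEigenspace] at hx
    obtain ⟨r, hr⟩ := hx
    by_cases hx0 : x = 0
    · exact ⟨0, by simp [hx0]⟩
    rcases lt_trichotomy ‖μ‖ 1 with h | h | h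
    · exact ⟨0, (tendsto_pow_apply_of_genEigenvector hT h r x hr).comp
        (tendsto_id.const_mul_atTop' ha0)⟩
    · have he := eigenvector_of_genEigenvector hT h r x hr
      have h1 := transfer_eigenvalue_pow hk δ h hx0 he ha
      have h2 : ∀ n, (transfer ℂ δ ^ n) x = μ ^ n • x := by
        intro n
        induction n with
        | zero => simp
        | succ n ih => rw [pow_succ', Module.End.mul_apply, ih, map_smul, he, smul_smul, pow_succ]
      refine ⟨x, ?_⟩
      refine tendsto_const_nhds.congr fun n => ?_
      rw [h2, pow_mul, h1, one_pow, one_smul]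
    · exfalso
      -- As `T` does not increase norms, it has no eigenvector for `‖μ‖ > 1`, so no power of `T - μ`
      -- kills `x`.
      have hinj : ∀ y, (transfer ℂ δ - μ • 1) y = 0 → y = 0 := by
        intro y hy
        have h1 : transfer ℂ δ y = μ • y := by simpa [sub_eq_zero] using hy
        have h2 := norm_transfer_le δ y
        rw [h1, norm_smul] at h2
        by_contra hy0
        have := norm_pos_iff.2 hy0
        nlinarith
      have : ∀ r : ℕ, ((transfer ℂ δ - μ • 1) ^ r) x = 0 → x = 0 := by
        intro r
        induction r with
        | zero => simp
        | succ r ih =>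
          intro h
          rw [pow_succ', Module.End.mul_apply] at h
          exact ih (hinj _ h)
      exact hx0 (this r hr)

theorem exists_tendsto_transfer_pow_real {Q : Type*} [Fintype Q] {k : ℕ} (hk : 0 < k)
    (δ : Q → Fin k → Q) {a : ℕ} (ha0 : 0 < a) (ha : ∀ i, 1 ≤ i → i ≤ Fintype.card Q → i ∣ a)
    (v : Q → ℝ) (q : Q) : ∃ p, Tendsto (fun n => (transfer ℝ δ ^ (a * n)) v q) atTop (𝓝 p) := by
  obtain ⟨p, hp⟩ := exists_tendsto_transfer_pow hk δ ha0 ha (fun q => (v q : ℂ))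
  have h1 := (tendsto_pi_nhds.1 hp) q
  refine ⟨(p q).re, ?_⟩
  refine ((Complex.continuous_re.tendsto _).comp h1).congr fun n => ?_
  have := transfer_pow_map Complex.ofRealHom δ (a * n) v q
  simp only [Complex.ofRealHom_eq_coe] at this
  simp [← this]

/-! ### Rational limits from a fixed vector and a coboundary -/

/-- If `v = p + (T ^ a y - y)` with `T ^ a p = p`, then `p` is the limit of the powers of `T ^ a` at
`v`. -/
theorem tendsto_transfer_pow_of_decomposition {Q : Type*} [Fintype Q] {k : ℕ} (hk : 0 < k)
    (δ : Q → Fin k → Q) {a : ℕ} (ha0 : 0 < a) (ha : ∀ i, 1 ≤ i → i ≤ Fintype.card Q → i ∣ a)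
    {v p y : Q → ℝ} (hp : (transfer ℝ δ ^ a) p = p) (hv : v = p + ((transfer ℝ δ ^ a) y - y))
    (q : Q) : Tendsto (fun n => (transfer ℝ δ ^ (a * n)) v q) atTop (𝓝 (p q)) := by
  obtain ⟨l, hl⟩ := exists_tendsto_transfer_pow_real hk δ ha0 ha y q
  have hpn : ∀ n, (transfer ℝ δ ^ (a * n)) p = p := by
    intro n
    induction n with
    | zero => simp
    | succ n ih => rw [mul_add, mul_one, pow_add, Module.End.mul_apply, hp, ih]
  -- On the coboundary the powers give the difference of consecutive terms of a convergent sequence.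
  have := ((hl.comp (tendsto_add_atTop_nat 1)).sub hl).const_add (p q)
  rw [sub_self, add_zero] at this
  refine this.congr fun n => ?_
  rw [hv, map_add, map_sub, hpn, ← Module.End.mul_apply, ← pow_add]
  simp [mul_add]

/-- The decomposition of a rational vector into a fixed vector and a coboundary of `T ^ a`. -/
theorem exists_decomposition {Q : Type*} [Fintype Q] {k : ℕ} (δ : Q → Fin k → Q) (a : ℕ)
    (v : Q → ℚ) : ∃ p y : Q → ℚ, (transfer ℚ δ ^ a) p = p ∧ v = p + ((transfer ℚ δ ^ a) y - y) := by
  set T := transfer ℚ δ ^ a with hT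
  -- If `u = T w - w` is fixed by `T`, then `T ^ n w = w + n u`, and boundedness forces `u = 0`. By
  -- rank-nullity, disjointness of kernel and range already makes them complementary.
  have hdisj : Disjoint (LinearMap.ker (T - 1)) (LinearMap.range (T - 1)) := by
    rw [Submodule.disjoint_def]
    rintro u hu ⟨w, hw⟩
    have hu' : T u = u := by simpa [sub_eq_zero] using hu
    have hw' : T w = w + u := by simp [← hw]
    have hpow : ∀ n : ℕ, (T ^ n) w = w + (n : ℚ) • u := by
      intro n
      induction n with
      | zero => simp
      | succ n ih =>
        rw [pow_succ', Module.End.mul_apply, ih, map_add, map_smul, hw', hu']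
        push_cast
        rw [add_smul, one_smul, add_assoc, add_comm u]
    have hz : (fun q => (u q : ℂ)) = 0 := by
      refine eq_zero_of_norm_bounded_smul (w := fun q => (w q : ℂ)) ‖fun q => (w q : ℂ)‖
        fun n => ⟨1, by simp, ?_⟩
      refine le_trans (le_of_eq ?_) (norm_transfer_pow_le δ (a * n) _)
      congr 1
      ext q
      have h1 := transfer_pow_map (Rat.castHom ℂ) δ (a * n) w q
      rw [pow_mul, ← hT, hpow] at h1
      simp at h1
      simp [h1]
    ext q
    simpa using congrFun hz q
  have hcompl : IsCompl (LinearMap.ker (T - 1)) (LinearMap.range (T - 1)) := by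
    refine ⟨hdisj, ?_⟩
    rw [codisjoint_iff]
    apply Submodule.eq_top_of_finrank_eq
    have h1 := Submodule.finrank_sup_add_finrank_inf_eq (LinearMap.ker (T - 1))
      (LinearMap.range (T - 1))
    rw [hdisj.eq_bot, finrank_bot, add_zero] at h1
    rw [h1, add_comm]
    exact LinearMap.finrank_range_add_finrank_ker _
  have hv : v ∈ LinearMap.ker (T - 1) ⊔ LinearMap.range (T - 1) := by
    rw [hcompl.sup_eq_top]
    trivial
  obtain ⟨p, hp, z, ⟨y, rfl⟩, hpz⟩ := Submodule.mem_sup.1 hv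
  refine ⟨p, y, ?_, ?_⟩
  · simpa [sub_eq_zero] using hp
  · simp [← hpz]

/-! ### Words and base expansions -/

theorem wordVal_nil {k : ℕ} : wordVal ([] : List (Fin k)) = 0 := rfl

theorem wordVal_append {k : ℕ} (u v : List (Fin k)) :
    wordVal (u ++ v) = wordVal u * k ^ v.length + wordVal v := by
  simp [wordVal, Nat.ofDigits_append]
  ring

theorem wordVal_singleton {k : ℕ} (i : Fin k) : wordVal [i] = i := by
  simp [wordVal]

theorem wordVal_cons {k : ℕ} (i : Fin k) (w : List (Fin k)) :
    wordVal (i :: w) = i * k ^ w.length + wordVal w := by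
  rw [← List.singleton_append, wordVal_append, wordVal_singleton]

theorem wordVal_concat {k : ℕ} (w : List (Fin k)) (i : Fin k) :
    wordVal (w ++ [i]) = wordVal w * k + i := by
  rw [wordVal_append, wordVal_singleton, List.length_singleton, pow_one]

theorem wordVal_baseRep {k : ℕ} (hk : 2 ≤ k) (n : ℕ) : wordVal (baseRep k hk n) = n := by
  simp [wordVal, baseRep, List.map_pmap, Nat.ofDigits_digits]

theorem baseRep_zero {k : ℕ} (hk : 2 ≤ k) : baseRep k hk 0 = [] := by
  simp [baseRep]

/-- The excluded case `n = i = 0` would append a leading zero to the empty expansion of `0`. -/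
theorem baseRep_concat {k : ℕ} (hk : 2 ≤ k) (n : ℕ) (i : Fin k) (h : n ≠ 0 ∨ (i : ℕ) ≠ 0) :
    baseRep k hk (n * k + i) = baseRep k hk n ++ [i] := by
  have hd : Nat.digits k (n * k + i) = (i : ℕ) :: Nat.digits k n := by
    rw [mul_comm, add_comm]
    exact Nat.digits_add k hk i n i.2 h.symm
  apply List.map_injective_iff.2 Fin.val_injective
  simp [baseRep, List.map_pmap, hd]

theorem baseRep_head_ne_zero {k : ℕ} (hk : 2 ≤ k) {n : ℕ} {i : Fin k} {w : List (Fin k)}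
    (h : baseRep k hk n = i :: w) : (i : ℕ) ≠ 0 := by
  have h1 := congrArg (fun l => (l.map Fin.val).reverse) h
  simp [baseRep, List.map_pmap] at h1
  have hne : Nat.digits k n ≠ [] := by simp [h1]
  have := Nat.getLast_digit_ne_zero k (m := n) (by rintro rfl; simp at hne)
  simpa [h1] using this

/-! ### Partial sums as lexicographic sums -/

/-- The recursion satisfied by the sums of an output over all words of given length. -/
def IsAdditive {Q : Type*} {k : ℕ} (δ : Q → Fin k → Q) (φ : Q → ℕ → ℝ) : Prop :=
  ∀ q n, φ q (n + 1) = ∑ i, φ (δ q i) n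

/-- The total weight of the words of length `|w| + n` whose prefix of length `|w|` precedes `w`,
where `φ q n` is the total weight of the words of length `n` read from the state `q`. -/
def lexSum {Q : Type*} {k : ℕ} (δ : Q → Fin k → Q) (φ : Q → ℕ → ℝ) :
    Q → ℕ → List (Fin k) → ℝ
  | _, _, [] => 0
  | q, n, i :: w => ∑ i' ∈ Finset.Iio i, φ (δ q i') (n + w.length) + lexSum δ φ (δ q i) n w

section Words

variable {Q : Type*} {k : ℕ} (δ : Q → Fin k → Q)

/-- A smaller word first deviates from `u ++ v` either inside `u` or inside `v`. -/
theorem lexSum_append (φ : Q → ℕ → ℝ) (q : Q) (n : ℕ) (u v : List (Fin k)) :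
    lexSum δ φ q n (u ++ v) = lexSum δ φ q (n + v.length) u + lexSum δ φ (u.foldl δ q) n v := by
  induction u generalizing q with
  | nil => simp [lexSum]
  | cons i u ih =>
    simp only [List.cons_append, lexSum, ih, List.foldl_cons, List.length_append]
    rw [show n + (u.length + v.length) = n + v.length + u.length by ring]
    ring

theorem lexSum_singleton (φ : Q → ℕ → ℝ) (q : Q) (n : ℕ) (i : Fin k) :
    lexSum δ φ q n [i] = ∑ i' ∈ Finset.Iio i, φ (δ q i') n := by
  simp [lexSum]

/-- A letter `i` with `n + l` positions below it contributes `i` errors of at most `ε * k ^ (n +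
l)`; these bounds add up to the value of the word. -/
theorem abs_lexSum_sub_le {φ ψ : Q → ℕ → ℝ} {ε : ℝ} {n₁ : ℕ}
    (h : ∀ n, n₁ ≤ n → ∀ q, |φ q n - ψ q n| ≤ ε * k ^ n) {n : ℕ} (hn : n₁ ≤ n) (q : Q)
    (w : List (Fin k)) :
    |lexSum δ φ q n w - lexSum δ ψ q n w| ≤ ε * k ^ n * wordVal w := by
  induction w generalizing q with
  | nil => simp [lexSum, wordVal_nil]
  | cons i w ih =>
    simp only [lexSum]
    rw [add_sub_add_comm, ← Finset.sum_sub_distrib]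
    refine (abs_add_le _ _).trans ?_
    have h1 : |∑ i' ∈ Finset.Iio i, (φ (δ q i') (n + w.length) - ψ (δ q i') (n + w.length))|
        ≤ i * (ε * k ^ (n + w.length)) := by
      refine (Finset.abs_sum_le_sum_abs _ _).trans ?_
      refine (Finset.sum_le_card_nsmul _ _ _ fun i' _ => h _ (by omega) (δ q i')).trans ?_
      simp
    refine (add_le_add h1 (ih _)).trans (le_of_eq ?_)
    rw [wordVal_cons]
    push_cast
    ring

variable {h : ℕ → ℚ≥0} {S : Q → ℕ → ℝ} {s₀ : Q}

theorem sum_fin_Iio_eq_sum_range {M : Type*} [AddCommMonoid M] (i : Fin k) (f : ℕ → M) :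
    ∑ i' ∈ Finset.Iio i, f i' = ∑ i' ∈ Finset.range i, f i' := by
  have : Finset.range i = (Finset.Iio i).map Fin.valEmbedding := by
    rw [Fin.map_valEmbedding_Iio, Nat.Iio_eq_range]
  rw [this, Finset.sum_map]
  rfl

/-- The words `u` followed by `n` letters represent a full interval of length `k ^ n`. Splitting it
by the next letter reproduces the recursion for `S`, and the pieces telescope. -/
theorem partialSum_block (hS : IsAdditive δ S)
    (hS0 : ∀ w : List (Fin k), (h (wordVal w) : ℝ) = S (w.foldl δ s₀) 0)
    (n : ℕ) (u : List (Fin k)) :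
    (partialSum h ((wordVal u + 1) * k ^ n) : ℝ) - partialSum h (wordVal u * k ^ n) =
      S (u.foldl δ s₀) n := by
  induction n generalizing u with
  | zero => simp [partialSum, Finset.sum_range_succ, hS0]
  | succ n ih =>
    rw [hS]
    have h1 : ∀ i : Fin k, S (δ (u.foldl δ s₀) i) n =
        (partialSum h ((wordVal u * k + (i + 1 : ℕ)) * k ^ n) : ℝ) -
          partialSum h ((wordVal u * k + (i : ℕ)) * k ^ n) := by
      intro i
      have := ih (u ++ [i])
      rw [wordVal_concat] at this
      rw [List.foldl_append] at this
      exact this.symm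
    rw [Finset.sum_congr rfl fun i _ => h1 i, Fin.sum_univ_eq_sum_range
      (fun i => (partialSum h ((wordVal u * k + (i + 1 : ℕ)) * k ^ n) : ℝ) -
          partialSum h ((wordVal u * k + (i : ℕ)) * k ^ n)) k,
      Finset.sum_range_sub (fun i => (partialSum h ((wordVal u * k + i) * k ^ n) : ℝ))]
    congr 3
    · ring_nf
    · ring_nf

/-- The partial sum up to a number whose expansion starts with `A` and ends with `n` zeros. -/
theorem partialSum_eq_lexSum (hS : IsAdditive δ S)
    (hS0 : ∀ w : List (Fin k), (h (wordVal w) : ℝ) = S (w.foldl δ s₀) 0)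
    (n : ℕ) (A : List (Fin k)) :
    (partialSum h (wordVal A * k ^ n) : ℝ) = lexSum δ S s₀ n A := by
  induction A using List.reverseRecOn generalizing n with
  | nil => simp [partialSum, wordVal_nil, lexSum]
  | append_singleton A i ih =>
    rw [lexSum_append, List.length_singleton, ← ih, lexSum_singleton]
    have h1 : ∀ i : Fin k, S (δ (A.foldl δ s₀) i) n =
        (partialSum h ((wordVal A * k + (i + 1 : ℕ)) * k ^ n) : ℝ) -
          partialSum h ((wordVal A * k + (i : ℕ)) * k ^ n) := by
      intro i
      have := partialSum_block δ hS hS0 n (A ++ [i])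
      rw [wordVal_concat] at this
      rw [List.foldl_append] at this
      exact this.symm
    rw [Finset.sum_congr rfl fun i _ => h1 i, sum_fin_Iio_eq_sum_range i
      (fun i => (partialSum h ((wordVal A * k + (i + 1 : ℕ)) * k ^ n) : ℝ) -
          partialSum h ((wordVal A * k + (i : ℕ)) * k ^ n)),
      Finset.sum_range_sub (fun i => (partialSum h ((wordVal A * k + i) * k ^ n) : ℝ)),
      wordVal_concat]
    simp only [add_zero]
    rw [show wordVal A * k ^ (n + 1) = wordVal A * k * k ^ n by ring]
    ring

theorem partialSum_add_le {h : ℕ → ℚ≥0} {H : ℝ} (hH : ∀ n, (h n : ℝ) ≤ H) (a b : ℕ) :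
    (partialSum h (a + b) : ℝ) ≤ partialSum h a + H * b := by
  induction b with
  | zero => simp
  | succ b ih =>
    have : partialSum h (a + (b + 1)) = partialSum h (a + b) + h (a + b) :=
      Finset.sum_range_succ _ _
    rw [this]
    push_cast
    linarith [hH (a + b)]

theorem isBoundedUnder_mean {h : ℕ → ℚ≥0} {H : ℝ} (hH : ∀ n, (h n : ℝ) ≤ H) :
    IsBoundedUnder (· ≤ ·) atTop fun n : ℕ => (partialSum h n : ℝ) / (n : ℝ) := by
  refine isBoundedUnder_of ⟨H, fun n => ?_⟩
  have hH0 : 0 ≤ H := le_trans (by positivity) (hH 0)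
  refine div_le_of_le_mul₀ (by positivity) hH0 ?_
  simpa [partialSum] using partialSum_add_le hH 0 n

theorem isCoboundedUnder_mean {h : ℕ → ℚ≥0} :
    IsCoboundedUnder (· ≤ ·) atTop fun n : ℕ => (partialSum h n : ℝ) / (n : ℝ) :=
  isCoboundedUnder_le_of_le atTop (x := 0) fun n => by positivity

/-! ### The Bellman inequality and the upper mean -/

variable {W V : Q → ℕ → ℝ} {γ : ℝ}

/-- The Bellman inequality for letters implies the one for words. -/
theorem bellman_word_le
    (hB : ∀ q n i, ∑ i' ∈ Finset.Iio i, W (δ q i') n - γ * i * k ^ n + V (δ q i) n ≤ V q (n + 1))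
    (q : Q) (n : ℕ) (w : List (Fin k)) :
    lexSum δ W q n w - γ * wordVal w * k ^ n + V (w.foldl δ q) n ≤ V q (n + w.length) := by
  induction w generalizing q with
  | nil => simp [lexSum, wordVal_nil]
  | cons i w ih =>
    have h1 := hB q (n + w.length) i
    have h2 := ih (δ q i)
    rw [wordVal_cons, lexSum, List.foldl_cons, List.length_cons, ← add_assoc]
    push_cast
    rw [pow_add] at h1
    linarith

theorem exists_bellman_word_eq
    (hB : ∀ q n, ∃ i, ∑ i' ∈ Finset.Iio i, W (δ q i') n - γ * i * k ^ n + V (δ q i) n = V q (n + 1))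
    (q : Q) (n l : ℕ) : ∃ w : List (Fin k), w.length = l ∧
    lexSum δ W q n w - γ * wordVal w * k ^ n + V (w.foldl δ q) n = V q (n + l) := by
  induction l generalizing q with
  | zero => exact ⟨[], rfl, by simp [lexSum, wordVal_nil]⟩
  | succ l ih =>
    obtain ⟨i, hi⟩ := hB q (n + l)
    obtain ⟨w, rfl, hw⟩ := ih (δ q i)
    refine ⟨i :: w, rfl, ?_⟩
    rw [wordVal_cons, lexSum, List.foldl_cons, ← add_assoc]
    push_cast
    rw [pow_add] at hi
    linarith

-- The last `n₁` digits of `N` are ignored. For the leading digits, `hF` handles the first letter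
-- and the Bellman inequality the others; replacing `S` by `W` costs a small multiple of `N`.
variable (s₀) in
theorem upperMean_le [Finite Q] (hk : 2 ≤ k) (hS : IsAdditive δ S)
    (hS0 : ∀ w : List (Fin k), (h (wordVal w) : ℝ) = S (w.foldl δ s₀) 0)
    (hSW : ∀ ε > 0, ∃ n₁, ∀ n, n₁ ≤ n → ∀ q, |S q n - W q n| ≤ ε * k ^ n)
    {C : ℝ} (hV : ∀ q n, |V q n| ≤ C * k ^ n) (hγ : 0 ≤ γ)
    (hB : ∀ q n i, ∑ i' ∈ Finset.Iio i, W (δ q i') n - γ * i * k ^ n + V (δ q i) n ≤ V q (n + 1))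
    (hF : ∀ n (i : Fin k), (i : ℕ) ≠ 0 →
      ∑ i' ∈ Finset.Iio i, W (δ s₀ i') n + V (δ s₀ i) n ≤ γ * i * k ^ n) :
    upperMean h ≤ γ := by
  obtain ⟨q₁, hq₁⟩ : ∃ q₁, ∀ q, S q 0 ≤ S q₁ 0 :=
    haveI : Nonempty Q := ⟨s₀⟩
    Finite.exists_max fun q => S q 0
  set H := S q₁ 0
  have hH : ∀ n, (h n : ℝ) ≤ H := by
    intro n
    have := hS0 (baseRep k hk n)
    rw [wordVal_baseRep] at this
    rw [this]
    exact hq₁ _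
  have hH0 : 0 ≤ H := le_trans (by positivity) (hH 0)
  refine le_of_forall_pos_le_add fun ε hε => ?_
  refine limsup_le_of_le isCoboundedUnder_mean ?_
  obtain ⟨n₁, hn₁⟩ := hSW (ε / 2) (half_pos hε)
  have hkpos : 0 < k ^ n₁ := by positivity
  -- From `N₀` on, the ignored digits (at most `H * k ^ n₁`) and the final value of `V` (at most `C
  -- * k ^ n₁`) together cost at most `ε / 2 * N`.
  obtain ⟨N₀, hN₀⟩ := exists_nat_ge ((C + H) * k ^ n₁ / (ε / 2))
  rw [div_le_iff₀ (half_pos hε)] at hN₀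
  filter_upwards [eventually_ge_atTop (max (k ^ n₁) N₀)] with N hN
  have hN1 : k ^ n₁ ≤ N := (le_max_left _ _).trans hN
  have hN2 : N₀ ≤ N := (le_max_right _ _).trans hN
  have hNpos : (0 : ℝ) < N := by exact_mod_cast hkpos.trans_le hN1
  rw [div_le_iff₀ hNpos]
  set A := baseRep k hk (N / k ^ n₁) with hA
  have hAval : wordVal A = N / k ^ n₁ := wordVal_baseRep hk _
  have hdiv : N / k ^ n₁ * k ^ n₁ + N % k ^ n₁ = N := Nat.div_add_mod' N _
  have hmod : N % k ^ n₁ < k ^ n₁ := Nat.mod_lt _ hkpos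
  have h1 : (partialSum h N : ℝ) ≤ partialSum h (wordVal A * k ^ n₁) + H * (N % k ^ n₁ : ℕ) := by
    rw [hAval]
    have := partialSum_add_le hH (N / k ^ n₁ * k ^ n₁) (N % k ^ n₁)
    rwa [hdiv] at this
  have h2 : H * (N % k ^ n₁ : ℕ) ≤ H * k ^ n₁ := by
    gcongr
    exact_mod_cast hmod.le
  rw [partialSum_eq_lexSum δ hS hS0] at h1
  have h3 := (abs_le.1 (abs_lexSum_sub_le δ hn₁ le_rfl s₀ A)).2
  have h4 : lexSum δ W s₀ n₁ A + V (A.foldl δ s₀) n₁ ≤ γ * wordVal A * k ^ n₁ := by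
    rcases hAe : A with _ | ⟨i, w⟩
    · rw [hAe, wordVal_nil] at hAval
      have := Nat.div_pos hN1 hkpos
      omega
    · have hi := baseRep_head_ne_zero hk (hA.symm.trans hAe)
      have h5 := hF (n₁ + w.length) i hi
      have h6 := bellman_word_le δ hB (δ s₀ i) n₁ w
      rw [wordVal_cons, lexSum, List.foldl_cons]
      push_cast
      rw [pow_add] at h5
      linarith
  have h5 := (abs_le.1 (hV (A.foldl δ s₀) n₁)).1
  have h6 : (wordVal A : ℝ) * k ^ n₁ ≤ N := by
    rw [hAval]
    exact_mod_cast Nat.div_mul_le_self N _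
  have h7 : (γ + ε / 2) * ((wordVal A : ℝ) * k ^ n₁) ≤ (γ + ε / 2) * N := by
    gcongr
  have h8 : (N₀ : ℝ) * (ε / 2) ≤ N * (ε / 2) := by
    gcongr
  linarith

-- A first letter of value zero, followed greedily by letters with equality in the Bellman equation
-- down to the fixed level `n₁`, gives arbitrarily large numbers with ratio at least `γ - ε`.
variable (s₀) in
theorem le_upperMean [Finite Q] (hk : 2 ≤ k) (hS : IsAdditive δ S)
    (hS0 : ∀ w : List (Fin k), (h (wordVal w) : ℝ) = S (w.foldl δ s₀) 0)
    (hSW : ∀ ε > 0, ∃ n₁, ∀ n, n₁ ≤ n → ∀ q, |S q n - W q n| ≤ ε * k ^ n)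
    {C : ℝ} (hV : ∀ q n, |V q n| ≤ C * k ^ n)
    (hB : ∀ q n, ∃ i, ∑ i' ∈ Finset.Iio i, W (δ q i') n - γ * i * k ^ n + V (δ q i) n = V q (n + 1))
    (hF : ∀ M, ∃ n, M ≤ n ∧ ∃ i : Fin k, (i : ℕ) ≠ 0 ∧
      ∑ i' ∈ Finset.Iio i, W (δ s₀ i') n + V (δ s₀ i) n = γ * i * k ^ n) :
    γ ≤ upperMean h := by
  obtain ⟨q₁, hq₁⟩ : ∃ q₁, ∀ q, S q 0 ≤ S q₁ 0 :=
    haveI : Nonempty Q := ⟨s₀⟩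
    Finite.exists_max fun q => S q 0
  have hH : ∀ n, (h n : ℝ) ≤ S q₁ 0 := by
    intro n
    have := hS0 (baseRep k hk n)
    rw [wordVal_baseRep] at this
    rw [this]
    exact hq₁ _
  refine le_of_forall_pos_sub_le fun ε hε => ?_
  refine le_limsup_of_frequently_le ?_ (isBoundedUnder_mean hH)
  obtain ⟨n₁, hn₁⟩ := hSW (ε / 2) (half_pos hε)
  have hkpos : 0 < k ^ n₁ := by positivity
  obtain ⟨N₀, hN₀⟩ := exists_nat_ge (C / (ε / 2))
  rw [div_le_iff₀ (half_pos hε)] at hN₀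
  rw [frequently_atTop]
  intro M
  -- The word will have at least `M + N₀` letters after `i`, so its value exceeds both `M` and `N₀`.
  obtain ⟨n, hn, i, hi, hFi⟩ := hF (n₁ + M + N₀)
  obtain ⟨w, hw, hwe⟩ := exists_bellman_word_eq δ hB (δ s₀ i) n₁ (n - n₁)
  rw [Nat.add_sub_cancel' (by omega)] at hwe
  have hval : M + N₀ ≤ wordVal (i :: w) := by
    have h1 : w.length < k ^ w.length := Nat.lt_pow_self (by omega)
    have h2 : 1 * k ^ w.length ≤ i * k ^ w.length :=
      Nat.mul_le_mul_right _ (Nat.one_le_iff_ne_zero.2 hi)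
    rw [wordVal_cons]
    omega
  have hvpos : 0 < wordVal (i :: w) := by
    rw [wordVal_cons]
    have : 0 < k ^ w.length := by positivity
    have := Nat.mul_pos (Nat.pos_of_ne_zero hi) this
    omega
  refine ⟨wordVal (i :: w) * k ^ n₁, by nlinarith, ?_⟩
  have hkpos' : (0 : ℝ) < (k : ℝ) ^ n₁ := by exact_mod_cast hkpos
  have hvpos' : (0 : ℝ) < wordVal (i :: w) := by exact_mod_cast hvpos
  rw [partialSum_eq_lexSum δ hS hS0]
  push_cast
  rw [le_div_iff₀ (by positivity)]
  have h3 := (abs_le.1 (abs_lexSum_sub_le δ hn₁ le_rfl s₀ (i :: w))).1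
  have h4 : lexSum δ W s₀ n₁ (i :: w) + V ((i :: w).foldl δ s₀) n₁ =
      γ * wordVal (i :: w) * k ^ n₁ := by
    have hn' : n = n₁ + w.length := by omega
    rw [hn'] at hFi hwe
    rw [wordVal_cons, lexSum, List.foldl_cons]
    push_cast
    rw [pow_add] at hFi
    linarith
  have h5 := (abs_le.1 (hV ((i :: w).foldl δ s₀) n₁)).2
  have h6 : C ≤ (ε / 2) * wordVal (i :: w) := by
    have : (N₀ : ℝ) ≤ wordVal (i :: w) := by exact_mod_cast (by omega : N₀ ≤ wordVal (i :: w))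
    nlinarith
  have h7 := mul_le_mul_of_nonneg_right h6 hkpos'.le
  linarith

end Words

/-! ### Discounted decision processes and scaling weights -/

/-- The optimality equation of a finite deterministic decision process with discount factor `1 / k`
has a solution. -/
theorem exists_discounted_optimum {P ι : Type*} [Fintype P] [Fintype ι] [Nonempty ι] {k : ℝ}
    (hk : 1 < k) (next : P → ι → P) (r : P → ι → ℝ) :
    ∃ v : P → ℝ, ∀ p, (∀ i, r p i + v (next p i) ≤ k * v p) ∧ ∃ i, r p i + v (next p i) = k * v p := by
  have hk0 : 0 < k := by linarith
  -- Value iteration: this operator contracts the sup distance by `k⁻¹`, and its fixed point is the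
  -- required solution.
  let T : (P → ℝ) → P → ℝ := fun v p =>
    k⁻¹ * Finset.univ.sup' Finset.univ_nonempty fun i => r p i + v (next p i)
  have hsup : ∀ u v : P → ℝ, ∀ p,
      Finset.univ.sup' Finset.univ_nonempty (fun i => r p i + u (next p i)) ≤
        Finset.univ.sup' Finset.univ_nonempty (fun i => r p i + v (next p i)) + dist u v := by
    intro u v p
    refine Finset.sup'_le _ _ fun i _ => ?_
    have h1 := Finset.le_sup' (fun i => r p i + v (next p i)) (Finset.mem_univ i)
    have h2 := (le_abs_self _).trans ((Real.dist_eq _ _).ge.trans (dist_le_pi_dist u v (next p i)))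
    linarith
  have hlip : LipschitzWith (Real.toNNReal k⁻¹) T := by
    refine LipschitzWith.of_dist_le_mul fun u v => ?_
    rw [Real.coe_toNNReal _ (by positivity)]
    refine (dist_pi_le_iff (by positivity)).2 fun p => ?_
    rw [Real.dist_eq, ← mul_sub, abs_mul, abs_of_pos (by positivity : 0 < k⁻¹)]
    refine mul_le_mul_of_nonneg_left (abs_le.2 ⟨?_, ?_⟩) (by positivity)
    · have := hsup v u p
      rw [dist_comm] at this
      linarith
    · have := hsup u v p
      linarith
  have hT : ContractingWith (Real.toNNReal k⁻¹) T := by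
    refine ⟨?_, hlip⟩
    rw [Real.toNNReal_lt_one]
    exact inv_lt_one_of_one_lt₀ hk
  have hfix : T (hT.fixedPoint T) = hT.fixedPoint T := hT.fixedPoint_isFixedPt
  refine ⟨hT.fixedPoint T, fun p => ?_⟩
  have h1 := congrFun hfix p
  have h2 : k * hT.fixedPoint T p =
      Finset.univ.sup' Finset.univ_nonempty fun i => r p i + hT.fixedPoint T (next p i) := by
    rw [← h1]
    simp only [T]
    rw [mul_inv_cancel_left₀ hk0.ne']
  rw [h2]
  refine ⟨fun i => Finset.le_sup' (fun i => r p i + hT.fixedPoint T (next p i)) (Finset.mem_univ i), ?_⟩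
  obtain ⟨i, -, hi⟩ := Finset.exists_mem_eq_sup' Finset.univ_nonempty
    fun i => r p i + hT.fixedPoint T (next p i)
  exact ⟨i, hi.symm⟩

/-- Multiplication of the index by `a` steps multiplies the weight by `k ^ a`. -/
def ScalesBy {Q : Type*} (k a : ℕ) (φ : Q → ℕ → ℝ) : Prop :=
  ∀ q n, φ q (n + a) = k ^ a * φ q n

theorem ScalesBy.of_dvd {Q : Type*} {k a b : ℕ} {φ : Q → ℕ → ℝ} (h : ScalesBy k a φ) (hab : a ∣ b) :
    ScalesBy k b φ := by
  obtain ⟨t, rfl⟩ := hab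
  induction t with
  | zero => intro q n; simp
  | succ t ih =>
    intro q n
    rw [mul_add, mul_one, ← add_assoc, h, ih, pow_add]
    ring

/-- `φ q n / k ^ n` depends only on `q` and `n % a`, so it takes finitely many values. -/
theorem ScalesBy.exists_bound {Q : Type*} [Finite Q] {k a : ℕ} {φ : Q → ℕ → ℝ}
    (hk : 0 < k) (ha : 0 < a) (h : ScalesBy k a φ) : ∃ C, ∀ q n, |φ q n| ≤ C * k ^ n := by
  cases nonempty_fintype Q
  refine ⟨∑ p : Q × Fin a, |φ p.1 p.2|, fun q n => ?_⟩
  have h1 := h.of_dvd (Dvd.intro (n / a) rfl) q (n % a)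
  rw [Nat.mod_add_div] at h1
  have h2 : |φ q (n % a)| ≤ ∑ p : Q × Fin a, |φ p.1 p.2| :=
    Finset.single_le_sum (f := fun p : Q × Fin a => |φ p.1 p.2|) (fun _ _ => abs_nonneg _)
      (Finset.mem_univ (q, ⟨n % a, Nat.mod_lt _ ha⟩))
  have h3 : (k : ℝ) ^ (a * (n / a)) ≤ k ^ n :=
    pow_le_pow_right₀ (by exact_mod_cast hk) (Nat.mul_div_le n a)
  rw [h1, abs_mul, abs_of_nonneg (by positivity), mul_comm]
  gcongr

section Pump

variable {Q : Type*} {k : ℕ} (δ : Q → Fin k → Q) {a : ℕ} {W V : Q → ℕ → ℝ} {γ : ℝ}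

theorem ScalesBy.lexSum (hW : ScalesBy k a W) (n : ℕ) (q : Q) (w : List (Fin k)) :
    lexSum δ W q (n + a) w = k ^ a * lexSum δ W q n w := by
  induction w generalizing q with
  | nil => simp [_root_.lexSum]
  | cons i w ih =>
    simp only [_root_.lexSum, ih]
    rw [mul_add, Finset.mul_sum]
    congr 1
    refine Finset.sum_congr rfl fun i' _ => ?_
    rw [← hW]
    congr 1
    ring

/-- Solvability of the Bellman equation for weights that scale with period `a`. -/
theorem exists_bellman [Fintype Q] (hk : 2 ≤ k) (ha : 0 < a) (hW : ScalesBy k a W) (γ : ℝ) :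
    ∃ V : Q → ℕ → ℝ, ScalesBy k a V ∧
      (∀ q n i, ∑ i' ∈ Finset.Iio i, W (δ q i') n - γ * i * k ^ n + V (δ q i) n ≤ V q (n + 1)) ∧
      ∀ q n, ∃ i,
        ∑ i' ∈ Finset.Iio i, W (δ q i') n - γ * i * k ^ n + V (δ q i) n = V q (n + 1) := by
  have : NeZero a := ⟨ha.ne'⟩
  have : Nonempty (Fin k) := ⟨⟨0, by omega⟩⟩
  have hk0 : (0 : ℝ) < k := by exact_mod_cast (by omega : 0 < k)
  -- `v (q, n)` stands for `V q n / k ^ n`, which is to depend on the level only modulo `a`. Reading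
  -- a letter lowers the level by one, and the normalization by `k ^ n` becomes the discount.
  obtain ⟨v, hv⟩ := exists_discounted_optimum (P := Q × ZMod a) (k := k)
    (by exact_mod_cast (by omega : 1 < k))
    (fun p i => (δ p.1 i, p.2 - 1))
    (fun p i => ∑ i' ∈ Finset.Iio i, W (δ p.1 i') (p.2 - 1).val / k ^ (p.2 - 1).val - γ * i)
  have hWn : ∀ q (n : ℕ), W q (n % a) / k ^ (n % a) = W q n / k ^ n := by
    intro q n
    have h1 := hW.of_dvd (Dvd.intro (n / a) rfl) q (n % a)
    rw [Nat.mod_add_div] at h1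
    have h2 : (k : ℝ) ^ n = k ^ (n % a) * k ^ (a * (n / a)) := by
      rw [← pow_add, Nat.mod_add_div]
    rw [h1, h2]
    field_simp
  have hstep : ∀ q (n : ℕ), ∀ i : Fin k,
      (∑ i' ∈ Finset.Iio i, W (δ q i') n - γ * i * k ^ n + k ^ n * v (δ q i, (n : ZMod a))) =
      k ^ n * (∑ i' ∈ Finset.Iio i, W (δ q i') (((n + 1 : ℕ) : ZMod a) - 1).val /
        k ^ (((n + 1 : ℕ) : ZMod a) - 1).val - γ * i + v (δ q i, ((n + 1 : ℕ) : ZMod a) - 1)) := by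
    intro q n i
    have h1 : ((n + 1 : ℕ) : ZMod a) - 1 = n := by push_cast; ring
    rw [h1, ZMod.val_natCast]
    simp only [hWn]
    rw [← Finset.sum_div]
    field_simp
  refine ⟨fun q n => k ^ n * v (q, n), fun q n => ?_, fun q n i => ?_, fun q n => ?_⟩
  · simp [pow_add]
    ring
  · have := (hv (q, ((n + 1 : ℕ) : ZMod a))).1 i
    change _ ≤ (k : ℝ) ^ (n + 1) * v (q, ((n + 1 : ℕ) : ZMod a))
    rw [hstep, pow_succ, mul_assoc]
    exact mul_le_mul_of_nonneg_left this (by positivity)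
  · obtain ⟨i, hi⟩ := (hv (q, ((n + 1 : ℕ) : ZMod a))).2
    refine ⟨i, ?_⟩
    change _ = (k : ℝ) ^ (n + 1) * v (q, ((n + 1 : ℕ) : ZMod a))
    rw [hstep, pow_succ, mul_assoc, ← hi]

/-! ### Loops and pumping -/

/-- A word along which `d + 1` states are visited at multiples of `a` closes a loop. -/
theorem exists_loop [Fintype Q] (ha : 0 < a) (q : Q) (w : List (Fin k))
    (hw : w.length = (Fintype.card Q + 1) * a) :
    ∃ A B C : List (Fin k), w = A ++ (B ++ C) ∧ A ≠ [] ∧ B ≠ [] ∧ a ∣ A.length ∧ a ∣ B.length ∧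
      (A ++ B).foldl δ q = A.foldl δ q := by
  -- The states are sampled after `a`, `2a`, … letters; leaving out time zero makes `A` nonempty.
  obtain ⟨s, t, hst, he⟩ := Fintype.exists_ne_map_eq_of_card_lt
    (fun i : Fin (Fintype.card Q + 1) => (w.take ((i + 1) * a)).foldl δ q) (by simp)
  wlog hlt : s < t generalizing s t
  · exact this t s hst.symm he.symm (lt_of_le_of_ne (not_lt.1 hlt) hst.symm)
  have hlt' : (s : ℕ) + 1 ≤ t := hlt
  have ht : (t : ℕ) + 1 ≤ Fintype.card Q + 1 := t.2
  have h1 : ((s : ℕ) + 1) * a ≤ w.length := by rw [hw]; gcongr; omega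
  have h2 : ((t : ℕ) + 1) * a ≤ w.length := by rw [hw]; gcongr
  obtain ⟨r, hr⟩ := Nat.exists_eq_add_of_le hlt'
  have h3 : ((t : ℕ) + 1) * a = (s + 1) * a + (r + 1) * a := by rw [hr]; ring
  have hAB : w.take (((t : ℕ) + 1) * a) =
      w.take (((s : ℕ) + 1) * a) ++ (w.drop ((s + 1) * a)).take ((r + 1) * a) := by
    rw [h3, List.take_add]
  have hA : (w.take (((s : ℕ) + 1) * a)).length = (s + 1) * a := by simp [h1]
  have hB : ((w.drop (((s : ℕ) + 1) * a)).take ((r + 1) * a)).length = (r + 1) * a := by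
    rw [List.length_take, List.length_drop]
    omega
  refine ⟨w.take ((s + 1) * a), (w.drop ((s + 1) * a)).take ((r + 1) * a),
    w.drop ((t + 1) * a), ?_, ?_, ?_, ?_, ?_, ?_⟩
  · rw [← List.append_assoc, ← hAB, List.take_append_drop]
  · rw [← List.length_pos_iff_ne_nil, hA]
    positivity
  · rw [← List.length_pos_iff_ne_nil, hB]
    positivity
  · exact Dvd.intro_left _ hA.symm
  · exact Dvd.intro_left _ hB.symm
  · rw [← hAB]
    exact he.symm

/-- Both parts of a word with equality in the Bellman inequality satisfy equality. -/
theorem bellman_word_eq_of_append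
    (hB : ∀ q n i, ∑ i' ∈ Finset.Iio i, W (δ q i') n - γ * i * k ^ n + V (δ q i) n ≤ V q (n + 1))
    {q : Q} {n : ℕ} {u v : List (Fin k)}
    (h : lexSum δ W q n (u ++ v) - γ * wordVal (u ++ v) * k ^ n + V ((u ++ v).foldl δ q) n =
      V q (n + (u ++ v).length)) :
    lexSum δ W q (n + v.length) u - γ * wordVal u * k ^ (n + v.length) +
        V (u.foldl δ q) (n + v.length) = V q (n + v.length + u.length) ∧
      lexSum δ W (u.foldl δ q) n v - γ * wordVal v * k ^ n + V (v.foldl δ (u.foldl δ q)) n =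
        V (u.foldl δ q) (n + v.length) := by
  -- The two inequalities add up to the given equality, so neither is strict.
  have h1 := bellman_word_le δ hB q (n + v.length) u
  have h2 := bellman_word_le δ hB (u.foldl δ q) n v
  rw [lexSum_append, wordVal_append, List.foldl_append, List.length_append,
    show n + (u.length + v.length) = n + v.length + u.length by ring] at h
  push_cast at h
  have h3 : (k : ℝ) ^ (n + v.length) = k ^ n * k ^ v.length := pow_add _ _ _
  have h4 : γ * wordVal u * (k : ℝ) ^ (n + v.length) = γ * (wordVal u * k ^ v.length) * k ^ n := by
    rw [h3]; ring
  constructor <;> linarith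

/-- The pairs of words `(A, B)` of total length at most `N` such that `A` has no leading zero and
`B` labels a loop at the state reached by `A`. -/
def IsLoopPair (s₀ : Q) (a N : ℕ) (A B : List (Fin k)) : Prop :=
  A ≠ [] ∧ B ≠ [] ∧ (∀ x ∈ A.head?, x.val ≠ 0) ∧ a ∣ A.length ∧ a ∣ B.length ∧
    A.length + B.length ≤ N ∧ (A ++ B).foldl δ s₀ = A.foldl δ s₀

theorem exists_isLoopPair [Fintype Q] (hk : 2 ≤ k) (ha : 0 < a) (s₀ : Q) {N : ℕ}
    (hN : (Fintype.card Q + 1) * a ≤ N) : ∃ A B, IsLoopPair δ s₀ a N A B := by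
  have hpos : 0 < (Fintype.card Q + 1) * a := by positivity
  -- Any word without leading zero serves; the letter `1` exists because `2 ≤ k`.
  obtain ⟨A, B, C, he, hA, hB, hdA, hdB, hl⟩ := exists_loop δ ha s₀
    (List.replicate ((Fintype.card Q + 1) * a) (⟨1, hk⟩ : Fin k)) (by simp)
  refine ⟨A, B, hA, hB, fun x hx => ?_, hdA, hdB, ?_, hl⟩
  · have : x ∈ A := List.mem_of_head? hx
    have h2 : x ∈ List.replicate ((Fintype.card Q + 1) * a) (⟨1, hk⟩ : Fin k) := by
      rw [he]
      exact List.mem_append_left _ this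
    rw [List.eq_of_mem_replicate h2]
    simp
  · have := congrArg List.length he
    simp only [List.length_replicate, List.length_append] at this
    omega

theorem pow_length_sub_one_pos (hk : 2 ≤ k) {B : List (Fin k)} (hB : B ≠ []) :
    (0 : ℝ) < (k : ℝ) ^ B.length - 1 := by
  have h1 : 1 < k ^ B.length := Nat.one_lt_pow (by simpa using hB) (by omega)
  have h2 : (1 : ℝ) < (k : ℝ) ^ B.length := by exact_mod_cast h1
  linarith

/-- If no loop pair has a ratio above `γ`, then no first letter has a positive optimal value. -/
theorem first_letter_le_of_loopPair [Fintype Q] (hk : 2 ≤ k) (ha : 0 < a) {s₀ : Q} {N : ℕ}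
    (hN : (Fintype.card Q + 1) * a ≤ N) (hW : ScalesBy k a W) (hV : ScalesBy k a V)
    (hB : ∀ q n i, ∑ i' ∈ Finset.Iio i, W (δ q i') n - γ * i * k ^ n + V (δ q i) n ≤ V q (n + 1))
    (hBe : ∀ q n, ∃ i,
      ∑ i' ∈ Finset.Iio i, W (δ q i') n - γ * i * k ^ n + V (δ q i) n = V q (n + 1))
    (hmax : ∀ A B n, IsLoopPair δ s₀ a N A B →
      lexSum δ W s₀ n A + lexSum δ W (A.foldl δ s₀) n B / (k ^ B.length - 1) ≤
        γ * (wordVal A + wordVal B / (k ^ B.length - 1)) * k ^ n)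
    (n : ℕ) (i : Fin k) (hi : (i : ℕ) ≠ 0) :
    ∑ i' ∈ Finset.Iio i, W (δ s₀ i') n + V (δ s₀ i) n ≤ γ * i * k ^ n := by
  have hk0 : (0 : ℝ) < k := by exact_mod_cast (by omega : 0 < k)
  set L := (Fintype.card Q + 1) * a with hL
  have hLpos : 0 < L := by positivity
  -- With `i` in front the word has length `L`, a multiple of `a`. The optimal word `w` starts at
  -- level `n + L`, which scaling brings back to level `n`.
  obtain ⟨w, hw, hwe⟩ := exists_bellman_word_eq δ hBe (δ s₀ i) (n + 1) (L - 1)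
  obtain ⟨A, B, C, he, hA, hBne, hdA, hdB, hl⟩ := exists_loop δ ha s₀ (i :: w)
    (by rw [List.length_cons]; omega)
  obtain ⟨i', A', rfl⟩ := List.exists_cons_of_ne_nil hA
  rw [List.cons_append, List.cons.injEq] at he
  obtain ⟨rfl, rfl⟩ := he
  rw [List.length_append, List.length_append] at hw
  have hpair : IsLoopPair δ s₀ a N (i :: A') B := by
    refine ⟨hA, hBne, ?_, hdA, hdB, ?_, hl⟩
    · simpa using hi
    · rw [List.length_cons]
      omega
  rw [← hw, ← List.length_append, ← List.length_append] at hwe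
  obtain ⟨h1, h2⟩ := bellman_word_eq_of_append δ hB hwe
  obtain ⟨h3, -⟩ := bellman_word_eq_of_append δ hB h2
  rw [List.foldl_append] at hl
  simp only [List.foldl_cons] at hl
  set q := A'.foldl δ (δ s₀ i) with hq
  set m := n + 1 + C.length with hm
  rw [hl, hV.of_dvd hdB] at h3
  rw [List.length_append, show n + 1 + (B.length + C.length) = m + B.length by omega,
    hV.of_dvd hdB, (hW.of_dvd hdB).lexSum] at h1
  have h4 := hmax (i :: A') B m hpair
  have hKB := pow_length_sub_one_pos hk hBne
  have hkm : (0 : ℝ) < (k : ℝ) ^ m := by positivity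
  set K : ℝ := (k : ℝ) ^ B.length with hK
  rw [List.foldl_cons, ← hq] at h4
  -- the loop determines the optimal value at its base
  have h5 : V q m = (lexSum δ W q m B - γ * wordVal B * k ^ m) / (K - 1) := by
    rw [eq_div_iff hKB.ne']
    linarith
  -- With the loop value inserted, the bound on loop pairs says that `A` followed by `B` forever has
  -- nonpositive total reward.
  have h6 : lexSum δ W s₀ m (i :: A') - γ * wordVal (i :: A') * k ^ m + V q m ≤ 0 := by
    rw [h5, sub_div]
    have : γ * (wordVal (i :: A') + wordVal B / (K - 1)) * (k : ℝ) ^ m =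
      γ * wordVal (i :: A') * k ^ m + γ * wordVal B * k ^ m / (K - 1) := by ring
    linarith
  have hKpos : 0 < K := by linarith
  have h7 := mul_nonpos_of_nonneg_of_nonpos hKpos.le h6
  rw [lexSum, wordVal_cons, mul_add, mul_sub, mul_add, Finset.mul_sum] at h7
  -- The factor `K` raises the level `m + A'.length` to exactly `n + L`, because `A`, `B` and `C`
  -- together have length `L`.
  have h8 : ∀ i' : Fin k, K * W (δ s₀ i') (m + A'.length) = k ^ L * W (δ s₀ i') n := by
    intro i'
    rw [← hW.of_dvd (Dvd.intro_left _ rfl : a ∣ L), ← hW.of_dvd hdB]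
    congr 1
    rw [hm]
    omega
  have h9 : V (δ s₀ i) (m + B.length + A'.length) = k ^ L * V (δ s₀ i) n := by
    rw [← hV.of_dvd (Dvd.intro_left _ rfl : a ∣ L)]
    congr 1
    rw [hm]
    omega
  simp only [h8] at h7
  rw [h9] at h1
  have h10 : (k : ℝ) ^ L * k ^ n = K * k ^ m * k ^ A'.length := by
    rw [hK, ← pow_add, ← pow_add, ← pow_add]
    congr 1
    rw [hm]
    omega
  have h11 : (k : ℝ) ^ (m + B.length) = k ^ m * K := pow_add _ _ _
  rw [h11] at h1
  rw [← Finset.mul_sum] at h7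
  have hkL : (0 : ℝ) < (k : ℝ) ^ L := by positivity
  refine le_of_mul_le_mul_left ?_ hkL
  push_cast at h7
  have h12 : (k : ℝ) ^ L * (γ * i * k ^ n) = γ * i * (K * k ^ m * k ^ A'.length) := by
    rw [← h10]; ring
  rw [h12]
  linarith

/-- A loop pair with ratio `γ` yields a first letter whose optimal value is nonnegative. -/
theorem first_letter_ge_of_loopPair (hk : 2 ≤ k) {s₀ : Q} {N : ℕ} (hV : ScalesBy k a V)
    (hB : ∀ q n i, ∑ i' ∈ Finset.Iio i, W (δ q i') n - γ * i * k ^ n + V (δ q i) n ≤ V q (n + 1))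
    {A B : List (Fin k)} {n : ℕ} (hp : IsLoopPair δ s₀ a N A B)
    (heq : lexSum δ W s₀ n A + lexSum δ W (A.foldl δ s₀) n B / (k ^ B.length - 1) =
        γ * (wordVal A + wordVal B / (k ^ B.length - 1)) * k ^ n) :
    ∃ m, ∃ i : Fin k, (i : ℕ) ≠ 0 ∧
      γ * i * k ^ m ≤ ∑ i' ∈ Finset.Iio i, W (δ s₀ i') m + V (δ s₀ i) m := by
  obtain ⟨hA, hBne, hhead, -, hdB, -, hl⟩ := hp
  obtain ⟨i, A', rfl⟩ := List.exists_cons_of_ne_nil hA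
  rw [List.foldl_append] at hl
  rw [List.foldl_cons] at heq hl
  refine ⟨n + A'.length, i, hhead i rfl, ?_⟩
  have h1 := bellman_word_le δ hB (δ s₀ i) n A'
  have h2 := bellman_word_le δ hB (A'.foldl δ (δ s₀ i)) n B
  set q := A'.foldl δ (δ s₀ i) with hq
  rw [hl, hV.of_dvd hdB] at h2
  have hKB := pow_length_sub_one_pos hk hBne
  set K : ℝ := (k : ℝ) ^ B.length with hK
  -- Repeating `B` forever is one possible continuation from `q`, so its total reward is a lower
  -- bound for `V`.
  have h5 : (lexSum δ W q n B - γ * wordVal B * k ^ n) / (K - 1) ≤ V q n := by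
    rw [div_le_iff₀ hKB]
    linarith
  rw [sub_div] at h5
  rw [lexSum, wordVal_cons] at heq
  push_cast at heq
  rw [pow_add]
  have : γ * (i * k ^ A'.length + wordVal A' + wordVal B / (K - 1)) * (k : ℝ) ^ n =
      γ * i * (k ^ n * k ^ A'.length) + γ * wordVal A' * k ^ n +
        γ * wordVal B * k ^ n / (K - 1) := by ring
  linarith

theorem lexSum_mem (F : Subfield ℝ) (hW : ∀ q n, W q n ∈ F) (q : Q) (n : ℕ) (w : List (Fin k)) :
    lexSum δ W q n w ∈ F := by
  induction w generalizing q with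
  | nil => exact F.zero_mem
  | cons i w ih => exact F.add_mem (F.sum_mem fun _ _ => hW _ _) (ih _)

/-- The solution of the Bellman equation lies in the field generated by its data. -/
theorem bellman_mem [Fintype Q] (hk : 2 ≤ k) (ha : 0 < a) (F : Subfield ℝ) (hWF : ∀ q n, W q n ∈ F)
    (hγF : γ ∈ F) (hV : ScalesBy k a V)
    (hB : ∀ q n i, ∑ i' ∈ Finset.Iio i, W (δ q i') n - γ * i * k ^ n + V (δ q i) n ≤ V q (n + 1))
    (hBe : ∀ q n, ∃ i,
      ∑ i' ∈ Finset.Iio i, W (δ q i') n - γ * i * k ^ n + V (δ q i) n = V q (n + 1))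
    (q : Q) (n : ℕ) : V q n ∈ F := by
  have hk0 : (0 : ℝ) < k := by exact_mod_cast (by omega : 0 < k)
  have hword : ∀ q n (w : List (Fin k)), lexSum δ W q n w - γ * wordVal w * k ^ n ∈ F :=
    fun q n w => F.sub_mem (lexSum_mem δ F hWF q n w)
      (F.mul_mem (F.mul_mem hγF (natCast_mem F _)) (pow_mem (natCast_mem F _) _))
  -- An optimal word closes a loop. The loop equation is linear in `V` at its base with nonzero
  -- coefficient, and the path `A` carries the solution back to `q`.
  obtain ⟨w, hw, hwe⟩ := exists_bellman_word_eq δ hBe q n ((Fintype.card Q + 1) * a)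
  obtain ⟨A, B, C, rfl, hA, hBne, hdA, hdB, hl⟩ := exists_loop δ ha q w hw
  have hL : V q (n + (Fintype.card Q + 1) * a) =
      k ^ ((Fintype.card Q + 1) * a) * V q n := hV.of_dvd (Dvd.intro_left _ rfl) q n
  rw [← hw] at hwe hL
  obtain ⟨h1, h2⟩ := bellman_word_eq_of_append δ hB hwe
  obtain ⟨h3, -⟩ := bellman_word_eq_of_append δ hB h2
  rw [List.foldl_append] at hl
  rw [hl, hV.of_dvd hdB] at h3
  have hKB := pow_length_sub_one_pos hk hBne
  have h5 : V (A.foldl δ q) (n + C.length) ∈ F := by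
    have : V (A.foldl δ q) (n + C.length) = (lexSum δ W (A.foldl δ q) (n + C.length) B -
        γ * wordVal B * k ^ (n + C.length)) / (k ^ B.length - 1) := by
      rw [eq_div_iff hKB.ne']
      linarith
    rw [this]
    exact F.div_mem (hword _ _ _) (F.sub_mem (pow_mem (natCast_mem F _) _) F.one_mem)
  rw [List.length_append, show n + (B.length + C.length) = n + C.length + B.length by ring,
    hV.of_dvd hdB, show n + C.length + B.length + A.length = n + (A ++ (B ++ C)).length by
      simp only [List.length_append]; ring, hL] at h1
  have h6 : V q n = (k ^ (A ++ (B ++ C)).length : ℝ)⁻¹ *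
      (k ^ (A ++ (B ++ C)).length * V q n) := by
    rw [inv_mul_cancel_left₀ (by positivity)]
  rw [h6, ← h1]
  exact F.mul_mem (F.inv_mem (pow_mem (natCast_mem F _) _))
    (F.add_mem (hword _ _ _) (F.mul_mem (pow_mem (natCast_mem F _) _) h5))

variable {h : ℕ → ℚ≥0} {S : Q → ℕ → ℝ}

/-- A solution of the Bellman equation whose best first letter has optimal value zero certifies the
upper mean. -/
theorem upperMean_eq_of_bellman [Finite Q] (hk : 2 ≤ k) (ha : 0 < a) {s₀ : Q}
    (hS : IsAdditive δ S) (hS0 : ∀ w : List (Fin k), (h (wordVal w) : ℝ) = S (w.foldl δ s₀) 0)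
    (hSW : ∀ ε > 0, ∃ n₁, ∀ n, n₁ ≤ n → ∀ q, |S q n - W q n| ≤ ε * k ^ n)
    (hW : ScalesBy k a W) (hV : ScalesBy k a V) (hγ : 0 ≤ γ)
    (hB : ∀ q n i, ∑ i' ∈ Finset.Iio i, W (δ q i') n - γ * i * k ^ n + V (δ q i) n ≤ V q (n + 1))
    (hBe : ∀ q n, ∃ i,
      ∑ i' ∈ Finset.Iio i, W (δ q i') n - γ * i * k ^ n + V (δ q i) n = V q (n + 1))
    (hF : ∀ n (i : Fin k), (i : ℕ) ≠ 0 →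
      ∑ i' ∈ Finset.Iio i, W (δ s₀ i') n + V (δ s₀ i) n ≤ γ * i * k ^ n)
    (hFe : ∃ n, ∃ i : Fin k, (i : ℕ) ≠ 0 ∧
      γ * i * k ^ n ≤ ∑ i' ∈ Finset.Iio i, W (δ s₀ i') n + V (δ s₀ i) n) :
    upperMean h = γ := by
  obtain ⟨C, hC⟩ := hV.exists_bound (by omega) ha
  refine le_antisymm (upperMean_le δ s₀ hk hS hS0 hSW hC hγ hB hF)
    (le_upperMean δ s₀ hk hS hS0 hSW hC hBe fun M => ?_)
  obtain ⟨n, i, hi, hn⟩ := hFe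
  -- Scaling moves the equality at one level to arbitrarily high levels.
  refine ⟨n + a * M, by nlinarith, i, hi, ?_⟩
  have hd : a ∣ a * M := Dvd.intro _ rfl
  rw [hV.of_dvd hd, Finset.sum_congr rfl fun i' _ => hW.of_dvd hd (δ s₀ i') n, ← Finset.mul_sum,
    ← mul_add, le_antisymm (hF n i hi) hn]
  ring

end Pump

/-! ### Limits along residue classes -/

/-- The weights `k ^ n c q (n mod a)`. -/
def periodicWeight {Q : Type*} (k a : ℕ) (c : Q → ℕ → ℝ) (q : Q) (n : ℕ) : ℝ :=
  k ^ n * c q (n % a)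

theorem scalesBy_periodicWeight {Q : Type*} (k a : ℕ) (c : Q → ℕ → ℝ) :
    ScalesBy k a (periodicWeight k a c) := by
  intro q n
  simp only [periodicWeight, Nat.add_mod_right, pow_add]
  ring

section Limits

variable {Q : Type*} {k : ℕ} (δ : Q → Fin k → Q) {a : ℕ} {S : Q → ℕ → ℝ}
  {c : Q → ℕ → ℝ}

theorem tendsto_div_sub_periodic (ha : 0 < a) (hc : ∀ q, ∀ j < a,
      Tendsto (fun n : ℕ => S q (a * n + j) / (k : ℝ) ^ (a * n + j)) atTop (𝓝 (c q j)))
    (q : Q) (n : ℕ) :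
    Tendsto (fun t : ℕ => S q (n + a * t) / (k : ℝ) ^ (n + a * t)) atTop (𝓝 (c q (n % a))) := by
  refine ((hc q (n % a) (Nat.mod_lt _ ha)).comp (tendsto_add_atTop_nat (n / a))).congr fun t => ?_
  have : a * (t + n / a) + n % a = n + a * t := by
    rw [mul_add, add_assoc, Nat.div_add_mod]
    ring
  simp only [Function.comp_apply, this]

/-- There are finitely many states and residues, so the convergence is uniform. -/
theorem exists_forall_abs_sub_periodicWeight_le [Finite Q] (hk : 0 < k) (ha : 0 < a) (hc : ∀ q, ∀ j < a,
      Tendsto (fun n : ℕ => S q (a * n + j) / (k : ℝ) ^ (a * n + j)) atTop (𝓝 (c q j)))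
    (ε : ℝ) (hε : 0 < ε) :
    ∃ n₁, ∀ n, n₁ ≤ n → ∀ q, |S q n - periodicWeight k a c q n| ≤ ε * k ^ n := by
  have h1 : ∀ p : Q × Fin a, ∀ᶠ n in atTop,
      |S p.1 (a * n + p.2) / (k : ℝ) ^ (a * n + p.2) - c p.1 p.2| < ε := fun p => by
    have := (hc p.1 p.2 p.2.2).eventually (Metric.ball_mem_nhds _ hε)
    filter_upwards [this] with n hn
    rwa [Real.dist_eq] at hn
  obtain ⟨n₀, hn₀⟩ := eventually_atTop.1 (eventually_all.2 h1)
  refine ⟨a * n₀, fun n hn q => ?_⟩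
  have h2 := hn₀ (n / a) ((Nat.le_div_iff_mul_le ha).2 (by rwa [mul_comm])) (q, ⟨n % a, Nat.mod_lt _ ha⟩)
  simp only [Nat.div_add_mod] at h2
  have hkn : (0 : ℝ) < (k : ℝ) ^ n := by positivity
  have h3 : S q n - periodicWeight k a c q n = (S q n / k ^ n - c q (n % a)) * k ^ n := by
    rw [periodicWeight]
    field_simp
  rw [h3, abs_mul, abs_of_pos hkn]
  exact mul_le_mul_of_nonneg_right h2.le hkn.le

/-- The recursion for `S` passes to the limit along `n + a * t`. -/
theorem isAdditive_periodicWeight (hk : 0 < k) (ha : 0 < a) (hS : IsAdditive δ S) (hc : ∀ q, ∀ j < a,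
      Tendsto (fun n : ℕ => S q (a * n + j) / (k : ℝ) ^ (a * n + j)) atTop (𝓝 (c q j))) :
    IsAdditive δ (periodicWeight k a c) := by
  intro q n
  have hk0 : (k : ℝ) ≠ 0 := by exact_mod_cast hk.ne'
  have h1 := tendsto_finsetSum Finset.univ fun i _ => tendsto_div_sub_periodic (k := k) ha hc (δ q i) n
  have h2 := (tendsto_div_sub_periodic (k := k) ha hc q (n + 1)).mul_const (k : ℝ)
  have h3 := tendsto_nhds_unique (h2.congr fun t => ?_) h1
  · simp only [periodicWeight]
    rw [pow_succ, mul_assoc, mul_comm (k : ℝ), h3, Finset.mul_sum]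
  · rw [← Finset.sum_div, ← hS, show n + 1 + a * t = n + a * t + 1 by ring, pow_succ]
    field_simp

theorem IsAdditive.eq_transfer_pow (hk : 0 < k) (hS : IsAdditive δ S) (q : Q) (n : ℕ) :
    S q n / (k : ℝ) ^ n = (transfer ℝ δ ^ n) (fun q => S q 0) q := by
  induction n generalizing q with
  | zero => simp
  | succ n ih =>
    have hk0 : (k : ℝ) ≠ 0 := by exact_mod_cast hk.ne'
    rw [pow_succ' (transfer ℝ δ), Module.End.mul_apply, transfer_apply, hS]
    simp only [← ih]
    rw [← Finset.sum_div, pow_succ]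
    field_simp

end Limits

/-- The means along a residue class, given the decomposition of the output into a fixed vector and a
coboundary. -/
theorem IsAdditive.tendsto_of_decomposition {Q : Type*} [Fintype Q] {k : ℕ} (δ : Q → Fin k → Q)
    {a : ℕ} {S : Q → ℕ → ℝ} (hk : 0 < k) (ha0 : 0 < a)
    (ha : ∀ i, 1 ≤ i → i ≤ Fintype.card Q → i ∣ a) (hS : IsAdditive δ S) {p y : Q → ℝ}
    (hp : (transfer ℝ δ ^ a) p = p) (hv : (fun q => S q 0) = p + ((transfer ℝ δ ^ a) y - y))
    (q : Q) (j : ℕ) :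
    Tendsto (fun n : ℕ => S q (a * n + j) / (k : ℝ) ^ (a * n + j)) atTop
      (𝓝 ((transfer ℝ δ ^ j) p q)) := by
  induction j generalizing q with
  | zero =>
    refine (tendsto_transfer_pow_of_decomposition hk δ ha0 ha hp hv q).congr fun n => ?_
    rw [add_zero, hS.eq_transfer_pow δ hk]
  | succ j ih =>
    have h1 := (tendsto_finsetSum Finset.univ fun i _ => ih (δ q i)).const_mul ((k : ℝ)⁻¹)
    rw [pow_succ' (transfer ℝ δ), Module.End.mul_apply, transfer_apply]
    refine h1.congr fun n => ?_
    have hk0 : (k : ℝ) ≠ 0 := by exact_mod_cast hk.ne'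
    rw [← Finset.sum_div, ← hS, ← add_assoc, pow_succ]
    field_simp

/-! ### Leading zeros and finiteness of the kernel -/

section Automaton

variable {k : ℕ} {Q Δ : Type}

/-- The transitions of the automaton that reads words with leading zeros: the new initial state
`none` is left with the first nonzero letter. -/
def DFAO.paddedStep (Γ : DFAO (Fin k) Q Δ) : Option Q → Fin k → Option Q
  | none, i => if (i : ℕ) = 0 then none else some (Γ.step Γ.start i)
  | some q, i => some (Γ.step q i)

/-- The outputs of the automaton that reads words with leading zeros. -/
def DFAO.paddedOut (Γ : DFAO (Fin k) Q Δ) : Option Q → Δ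
  | none => Γ.out Γ.start
  | some q => Γ.out q

/-- `none` records that only zeros have been read. The given automaton may treat leading zeros
arbitrarily, since no expansion `(n)_k` has any. -/
theorem DFAO.foldl_paddedStep (hk : 2 ≤ k) (Γ : DFAO (Fin k) Q Δ) (w : List (Fin k)) :
    w.foldl Γ.paddedStep none = if wordVal w = 0 then none else
      some ((baseRep k hk (wordVal w)).foldl Γ.step Γ.start) := by
  induction w using List.reverseRecOn with
  | nil => simp [wordVal_nil]
  | append_singleton w i ih =>
    rw [List.foldl_append, ih, wordVal_concat, List.foldl_cons, List.foldl_nil]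
    by_cases hw : wordVal w = 0
    · by_cases hi : (i : ℕ) = 0
      · simp [hw, hi, DFAO.paddedStep]
      · have h1 := baseRep_concat hk 0 i (Or.inr hi)
        rw [zero_mul, zero_add, baseRep_zero, List.nil_append] at h1
        simp [hw, hi, DFAO.paddedStep, h1]
    · have h1 : wordVal w * k + i ≠ 0 := by
        have := Nat.mul_pos (Nat.pos_of_ne_zero hw) (by omega : 0 < k)
        omega
      rw [if_neg hw, if_neg h1, baseRep_concat hk _ i (Or.inl hw), List.foldl_append]
      rfl

theorem DFAO.Generates.paddedOut_foldl {hk : 2 ≤ k} {Γ : DFAO (Fin k) Q Δ} {h : ℕ → Δ}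
    (hΓ : Γ.Generates hk h) (w : List (Fin k)) :
    h (wordVal w) = Γ.paddedOut (w.foldl Γ.paddedStep none) := by
  rw [DFAO.foldl_paddedStep hk, hΓ, DFAO.output]
  split_ifs with hw
  · rw [hw, baseRep_zero]
    rfl
  · rfl

/-- `f_u` depends only on the state that the padded automaton reaches on `u`. -/
theorem finite_leftKernel (hk : 2 ≤ k) {h : ℕ → Δ} (hh : IsAutomatic hk h) :
    (leftKernel k h).Finite := by
  obtain ⟨m, Γ, hΓ⟩ := hh
  refine (Set.finite_range fun (q : Option (Fin m)) (w : List (Fin k)) =>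
    Γ.paddedOut (w.foldl Γ.paddedStep q)).subset ?_
  rintro _ ⟨u, rfl⟩
  refine ⟨u.foldl Γ.paddedStep none, funext fun w => ?_⟩
  rw [leftShift, wordMap, hΓ.paddedOut_foldl, List.foldl_append]

end Automaton

/-! ### Lexicographic sums as sums over words -/

section WordSums

variable {Q : Type*} {k : ℕ} {δ : Q → Fin k → Q} {φ : Q → ℕ → ℝ}

theorem sum_ofFn_succ {M : Type*} [AddCommMonoid M] (n : ℕ) (F : List (Fin k) → M) :
    ∑ v : Fin (n + 1) → Fin k, F (List.ofFn v) =
      ∑ i : Fin k, ∑ v : Fin n → Fin k, F (i :: List.ofFn v) := by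
  rw [← Fintype.sum_prod_type', ← (Fin.consEquiv fun _ : Fin (n + 1) => Fin k).sum_comp]
  refine Finset.sum_congr rfl fun p _ => ?_
  simp [Fin.consEquiv, List.ofFn_succ]

theorem IsAdditive.eq_sum_words (hφ : IsAdditive δ φ) (q : Q) (n l : ℕ) :
    φ q (n + l) = ∑ v : Fin l → Fin k, φ ((List.ofFn v).foldl δ q) n := by
  induction l generalizing q with
  | zero => simp
  | succ l ih =>
    rw [← add_assoc, hφ, sum_ofFn_succ l fun w => φ (w.foldl δ q) n]
    exact Finset.sum_congr rfl fun i _ => ih (δ q i)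

/-- The lexicographic sum as a sum over the words that precede the given one. -/
theorem IsAdditive.lexSum_eq_sum_words (hφ : IsAdditive δ φ) (q : Q) (n : ℕ) (A : List (Fin k)) :
    lexSum δ φ q n A =
      ∑ v : Fin A.length → Fin k with List.ofFn v < A, φ ((List.ofFn v).foldl δ q) n := by
  induction A generalizing q with
  | nil => simp [lexSum]
  | cons i A ih =>
    rw [Finset.sum_filter]
    have h1 := sum_ofFn_succ (k := k) A.length
      fun w => if w < i :: A then φ (w.foldl δ q) n else 0
    rw [List.length_cons, h1, lexSum, ih]
    -- A smaller first letter admits every tail, an equal one only the tails that precede `A`, a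
    -- larger one none.
    have h2 : ∀ i', (∑ v : Fin A.length → Fin k,
        if i' :: List.ofFn v < i :: A then φ ((i' :: List.ofFn v).foldl δ q) n else 0) =
        (if i' < i then φ (δ q i') (n + A.length) else 0) +
        if i' = i then (∑ v : Fin A.length → Fin k with List.ofFn v < A,
          φ ((List.ofFn v).foldl δ (δ q i)) n) else 0 := by
      intro i'
      simp only [List.cons_lt_cons_iff, List.foldl_cons]
      rcases lt_trichotomy i' i with hlt | rfl | hgt
      · simp [hlt, hlt.ne, hφ.eq_sum_words]
      · simp [Finset.sum_filter]
      · simp [hgt.not_gt, hgt.ne']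
    rw [Finset.sum_congr rfl fun i' _ => h2 i', Finset.sum_add_distrib, ← Finset.sum_filter]
    congr 1
    · refine Finset.sum_congr ?_ fun _ _ => rfl
      ext
      simp
    · simp

end WordSums

/-! ### The kernel as an automaton and the maximum formula -/

section Kernel

variable {k : ℕ} {h : ℕ → ℚ≥0}

/-- The kernel element `f_u`. -/
def kernelElement (k : ℕ) (h : ℕ → ℚ≥0) (u : List (Fin k)) : leftKernel k h :=
  ⟨leftShift (wordMap k h) u, u, rfl⟩

/-- The letter transitions on the left kernel. -/
def kernelStep (k : ℕ) (h : ℕ → ℚ≥0) (g : leftKernel k h) (i : Fin k) : leftKernel k h :=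
  ⟨leftShift g.1 [i], by
    obtain ⟨u, hu⟩ := g.2
    refine ⟨u ++ [i], ?_⟩
    rw [← hu]
    funext w
    simp [leftShift]⟩

theorem coe_foldl_kernelStep (g : leftKernel k h) (u : List (Fin k)) :
    (u.foldl (kernelStep k h) g : leftKernel k h).1 = leftShift g.1 u := by
  induction u generalizing g with
  | nil => rfl
  | cons i u ih =>
    rw [List.foldl_cons, ih]
    rfl

theorem foldl_kernelStep (u : List (Fin k)) :
    u.foldl (kernelStep k h) (kernelElement k h []) = kernelElement k h u :=
  Subtype.ext (coe_foldl_kernelStep _ _)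

theorem isAdditive_wordSum :
    IsAdditive (kernelStep k h) fun g n => (wordSum g.1 n : ℝ) := by
  intro g n
  simp only [wordSum]
  rw [sum_ofFn_succ]
  push_cast
  rfl

theorem wordSum_kernelElement_zero (w : List (Fin k)) :
    (h (wordVal w) : ℝ) = (wordSum (w.foldl (kernelStep k h) (kernelElement k h [])).1 0 : ℝ) := by
  rw [foldl_kernelStep]
  simp [wordSum, kernelElement, leftShift, wordMap]

/-- Existence of rational means along the residue classes modulo a number divisible by all numbers up
to the size of the kernel. -/
theorem exists_isMeanSystem (hk : 0 < k) (hfin : (leftKernel k h).Finite) {a : ℕ} (ha0 : 0 < a)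
    (ha : ∀ i, 1 ≤ i → i ≤ (leftKernel k h).ncard → i ∣ a) : ∃ c, IsMeanSystem k h a c := by
  classical
  have := hfin.fintype
  obtain ⟨p, y, hp, hv⟩ := exists_decomposition (kernelStep k h) a fun g => (g.1 [] : ℚ)
  refine ⟨fun g j => if hg : g ∈ leftKernel k h then (transfer ℚ (kernelStep k h) ^ j) p ⟨g, hg⟩
    else 0, fun g hg j _ => ?_⟩
  have hcast : ∀ n (f : leftKernel k h → ℚ) q, ((transfer ℚ (kernelStep k h) ^ n) f q : ℝ) =
      (transfer ℝ (kernelStep k h) ^ n) (fun q => (f q : ℝ)) q :=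
    fun n f q => transfer_pow_map (Rat.castHom ℝ) (kernelStep k h) n f q
  simp only [hg, dif_pos, hcast]
  refine isAdditive_wordSum.tendsto_of_decomposition (kernelStep k h) hk ha0 ?_
    (p := fun q => (p q : ℝ)) (y := fun q => (y q : ℝ)) ?_ ?_ ⟨g, hg⟩ j
  · rwa [← Nat.card_eq_fintype_card, Nat.card_coe_set_eq]
  · funext q
    rw [← hcast, hp]
  · funext q
    have := congrArg (Rat.cast : ℚ → ℝ) (congrFun hv q)
    simp only [Pi.add_apply, Pi.sub_apply] at this ⊢
    rw [← hcast]
    push_cast at this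
    simpa [wordSum] using this

variable {a : ℕ} {c : (List (Fin k) → ℚ≥0) → ℕ → ℚ}

/-- The means as weights on the kernel. -/
def kernelWeight (k : ℕ) (h : ℕ → ℚ≥0) (a : ℕ) (c : (List (Fin k) → ℚ≥0) → ℕ → ℚ) :
    leftKernel k h → ℕ → ℝ :=
  periodicWeight k a fun g j => (c g.1 j : ℝ)

theorem IsMeanSystem.isAdditive (hk : 0 < k) (ha : 0 < a) (hc : IsMeanSystem k h a c) :
    IsAdditive (kernelStep k h) (kernelWeight k h a c) :=
  isAdditive_periodicWeight (kernelStep k h) hk ha isAdditive_wordSum fun g j hj => hc g.1 g.2 j hj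

theorem IsMeanSystem.nonneg (hc : IsMeanSystem k h a c) {g} (hg : g ∈ leftKernel k h) {j : ℕ}
    (hj : j < a) : 0 ≤ c g j := by
  have := ge_of_tendsto' (hc g hg j hj) (b := (0 : ℝ)) fun n => by positivity
  exact_mod_cast this

theorem leftShift_mem_leftKernel {g} (hg : g ∈ leftKernel k h) (u : List (Fin k)) :
    leftShift g u ∈ leftKernel k h := by
  obtain ⟨v, rfl⟩ := hg
  exact ⟨v ++ u, funext fun w => by simp [leftShift]⟩

theorem IsMeanSystem.kappa_nonneg (hc : IsMeanSystem k h a c) {g} (hg : g ∈ leftKernel k h)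
    (A : List (Fin k)) {j : ℕ} (hj : j < a) : 0 ≤ kappa c g A j :=
  Finset.sum_nonneg fun _ _ => hc.nonneg (leftShift_mem_leftKernel hg _) hj

theorem IsMeanSystem.lexSum_eq (hk : 0 < k) (ha : 0 < a) (hc : IsMeanSystem k h a c)
    (g : leftKernel k h) (n : ℕ) (A : List (Fin k)) :
    lexSum (kernelStep k h) (kernelWeight k h a c) g n A = k ^ n * kappa c g.1 A (n % a) := by
  rw [(hc.isAdditive hk ha).lexSum_eq_sum_words, kappa]
  push_cast
  rw [Finset.mul_sum]
  refine Finset.sum_congr rfl fun v _ => ?_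
  rw [kernelWeight, periodicWeight, coe_foldl_kernelStep]

/-- With the kernel elements as states, `f_{AB} = f_A` says that `B` labels a loop at the state
reached by `A`. -/
theorem isPumpPair_iff {A B : List (Fin k)} : IsPumpPair k h a A B ↔
    IsLoopPair (kernelStep k h) (kernelElement k h []) a
      ((2 * (leftKernel k h).ncard + 1) * a) A B := by
  simp only [IsPumpPair, IsLoopPair, foldl_kernelStep, Subtype.ext_iff]
  rfl

theorem finite_pumpValues : (pumpValues k h a c).Finite := by
  set N := (2 * (leftKernel k h).ncard + 1) * a
  have hl : {w : List (Fin k) | w.length ≤ N}.Finite := List.finite_length_le _ _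
  refine (((hl.prod hl).prod (Set.finite_lt_nat a)).image
    fun p => pumpValue k h c p.1.1 p.1.2 p.2).subset ?_
  rintro _ ⟨A, B, j, hAB, hj, rfl⟩
  have := hAB.2.2.2.2.2.1
  exact ⟨((A, B), j), ⟨⟨by simp; omega, by simp; omega⟩, hj⟩, rfl⟩

theorem pow_length_sub_one_pos_rat (hk : 2 ≤ k) {B : List (Fin k)} (hB : B ≠ []) :
    (0 : ℚ) < (k : ℚ) ^ B.length - 1 := by
  have := pow_length_sub_one_pos hk hB
  exact_mod_cast this

theorem wordVal_pos_of_head {A : List (Fin k)} (hA : A ≠ [])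
    (hh : ∀ x ∈ A.head?, x.val ≠ 0) : 0 < wordVal A := by
  obtain ⟨i, A', rfl⟩ := List.exists_cons_of_ne_nil hA
  rw [wordVal_cons]
  have hi : (i : ℕ) ≠ 0 := hh i rfl
  have hk : 0 < k := i.pos
  have := Nat.mul_pos (Nat.pos_of_ne_zero hi) (pow_pos hk A'.length)
  omega

theorem pumpValue_denom_pos (hk : 2 ≤ k) {A B : List (Fin k)} (hp : IsPumpPair k h a A B) :
    (0 : ℚ) < (wordVal A : ℚ) + (wordVal B : ℚ) / ((k : ℚ) ^ B.length - 1) := by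
  have h1 := pow_length_sub_one_pos_rat hk hp.2.1
  have h2 : (0 : ℚ) < wordVal A := by exact_mod_cast wordVal_pos_of_head hp.1 hp.2.2.1
  positivity

theorem IsMeanSystem.pumpValue_nonneg (hk : 2 ≤ k) (hc : IsMeanSystem k h a c)
    {A B : List (Fin k)} (hp : IsPumpPair k h a A B) {j : ℕ} (hj : j < a) :
    0 ≤ pumpValue k h c A B j := by
  have h1 := pow_length_sub_one_pos_rat hk hp.2.1
  have h2 := hc.kappa_nonneg (g := wordMap k h) (kernelElement k h []).2 A hj
  have h3 := hc.kappa_nonneg (kernelElement k h A).2 B hj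
  exact div_nonneg (add_nonneg h2 (div_nonneg h3 h1.le)) (pumpValue_denom_pos hk hp).le

/-- The upper mean is the greatest pumping value. -/
theorem IsMeanSystem.exists_isGreatest (hk : 2 ≤ k) (hfin : (leftKernel k h).Finite) (ha : 0 < a)
    (hc : IsMeanSystem k h a c) :
    ∃ γ : ℚ, IsGreatest (pumpValues k h a c) γ ∧ upperMean h = γ := by
  have := hfin.fintype
  have hk0 : 0 < k := by omega
  have hk' : (0 : ℝ) < k := by exact_mod_cast hk0
  have hcard : Fintype.card (leftKernel k h) = (leftKernel k h).ncard := by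
    rw [← Nat.card_eq_fintype_card, Nat.card_coe_set_eq]
  have hN : (Fintype.card (leftKernel k h) + 1) * a ≤ (2 * (leftKernel k h).ncard + 1) * a := by
    rw [hcard]
    gcongr
    omega
  have hne : (pumpValues k h a c).Nonempty := by
    obtain ⟨A, B, hAB⟩ := exists_isLoopPair (kernelStep k h) hk ha (kernelElement k h []) hN
    exact ⟨_, A, B, 0, isPumpPair_iff.2 hAB, ha, rfl⟩
  obtain ⟨γ, hγ⟩ := finite_pumpValues.exists_maximal hne
  have hgr : IsGreatest (pumpValues k h a c) γ :=
    ⟨hγ.1, fun x hx => (le_total x γ).elim id fun hle => hγ.2 hx hle⟩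
  refine ⟨γ, hgr, ?_⟩
  have hW : ScalesBy k a (kernelWeight k h a c) := scalesBy_periodicWeight _ _ _
  -- The Bellman equation is solved for the largest pumping value `γ`: maximality bounds every first
  -- letter, and a maximizing pair attains the bound.
  obtain ⟨V, hV, hB, hBe⟩ := exists_bellman (kernelStep k h) hk ha hW (γ : ℝ)
  have hval : ∀ {A B : List (Fin k)} (n : ℕ), IsPumpPair k h a A B →
      lexSum (kernelStep k h) (kernelWeight k h a c) (kernelElement k h []) n A +
        lexSum (kernelStep k h) (kernelWeight k h a c)
          (A.foldl (kernelStep k h) (kernelElement k h [])) n B / ((k : ℝ) ^ B.length - 1) =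
      (pumpValue k h c A B (n % a) : ℝ) *
        (wordVal A + wordVal B / ((k : ℝ) ^ B.length - 1)) * k ^ n := by
    intro A B n hp
    have h1 := pumpValue_denom_pos hk hp
    rw [hc.lexSum_eq hk0 ha, hc.lexSum_eq hk0 ha, foldl_kernelStep]
    have h2 : pumpValue k h c A B (n % a) *
        ((wordVal A : ℚ) + (wordVal B : ℚ) / ((k : ℚ) ^ B.length - 1)) =
        kappa c (wordMap k h) A (n % a) +
          kappa c (leftShift (wordMap k h) A) B (n % a) / ((k : ℚ) ^ B.length - 1) :=
      div_mul_cancel₀ _ h1.ne'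
    have h3 := congrArg (Rat.cast : ℚ → ℝ) h2
    push_cast at h3
    rw [h3]
    change (k : ℝ) ^ n * kappa c (wordMap k h) A (n % a) +
      k ^ n * kappa c (leftShift (wordMap k h) A) B (n % a) / (k ^ B.length - 1) = _
    ring
  have hγ0 : (0 : ℝ) ≤ γ := by
    obtain ⟨A, B, j, hp, hj, rfl⟩ := hγ.1
    exact_mod_cast hc.pumpValue_nonneg hk hp hj
  refine upperMean_eq_of_bellman (kernelStep k h) (W := kernelWeight k h a c) hk ha (s₀ := kernelElement k h [])
    isAdditive_wordSum wordSum_kernelElement_zero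
    (exists_forall_abs_sub_periodicWeight_le hk0 ha fun g j hj => hc g.1 g.2 j hj) hW hV hγ0 hB hBe
    (first_letter_le_of_loopPair (kernelStep k h) hk ha hN hW hV hB hBe fun A B n hp => ?_) ?_
  · have hp' := isPumpPair_iff.2 hp
    rw [hval n hp']
    have h1 : ((pumpValue k h c A B (n % a) : ℚ) : ℝ) ≤ γ := by
      exact_mod_cast hgr.2 ⟨A, B, n % a, hp', Nat.mod_lt _ ha, rfl⟩
    have h2 := pow_length_sub_one_pos hk hp'.2.1
    gcongr
  · obtain ⟨A, B, j, hp, hj, hγe⟩ := hγ.1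
    refine first_letter_ge_of_loopPair (kernelStep k h) hk hV hB (isPumpPair_iff.1 hp) (n := j) ?_
    rw [hval j hp, Nat.mod_eq_of_lt hj, ← hγe]

end Kernel

/-! ### Certificates in natural numbers -/

section Certificates

variable {Q : Type*} {k : ℕ} {δ : Q → Fin k → Q} {a : ℕ} {W : Q → ℕ → ℝ}

theorem lexSum_nonneg (hW : ∀ q n, 0 ≤ W q n) (q : Q) (n : ℕ) (w : List (Fin k)) :
    0 ≤ lexSum δ W q n w := by
  induction w generalizing q with
  | nil => exact le_rfl
  | cons i w ih => exact add_nonneg (Finset.sum_nonneg fun _ _ => hW _ _) (ih _)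

/-- The value of a loop pair, read from level `n`. -/
noncomputable def loopValue (δ : Q → Fin k → Q) (W : Q → ℕ → ℝ) (s₀ : Q) (A B : List (Fin k))
    (n : ℕ) : ℝ :=
  (lexSum δ W s₀ n A + lexSum δ W (A.foldl δ s₀) n B / (k ^ B.length - 1)) /
    ((wordVal A + wordVal B / (k ^ B.length - 1)) * k ^ n)

theorem loopValue_mul (hk : 2 ≤ k) {s₀ : Q} {N : ℕ} {A B : List (Fin k)}
    (hp : IsLoopPair δ s₀ a N A B) (n : ℕ) :
    lexSum δ W s₀ n A + lexSum δ W (A.foldl δ s₀) n B / (k ^ B.length - 1) =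
      loopValue δ W s₀ A B n * (wordVal A + wordVal B / (k ^ B.length - 1)) * k ^ n := by
  have h1 := pow_length_sub_one_pos hk hp.2.1
  have h2 : (0 : ℝ) < wordVal A := by exact_mod_cast wordVal_pos_of_head hp.1 hp.2.2.1
  have h3 : (0 : ℝ) < k := by exact_mod_cast (by omega : 0 < k)
  rw [loopValue, mul_assoc, div_mul_cancel₀]
  positivity

/-- Only the levels below `a` matter, so loop pairs of bounded length have finitely many values. -/
theorem loopValue_mod (hk : 0 < k) (hW : ScalesBy k a W) (s₀ : Q) (A B : List (Fin k)) (n : ℕ) :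
    loopValue δ W s₀ A B n = loopValue δ W s₀ A B (n % a) := by
  have h1 : (k : ℝ) ^ (a * (n / a)) ≠ 0 := pow_ne_zero _ (by exact_mod_cast hk.ne')
  have h2 := fun q w => (hW.of_dvd (Dvd.intro (n / a) rfl)).lexSum δ (n % a) q w
  rw [Nat.mod_add_div] at h2
  have h3 : (k : ℝ) ^ n = k ^ (a * (n / a)) * k ^ (n % a) := by
    rw [← pow_add, Nat.div_add_mod]
  rw [loopValue, loopValue, h2, h2, h3, mul_div_assoc, ← mul_add, mul_left_comm,
    mul_div_mul_left _ _ h1]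

/-- Existence of the data that certify the upper mean, in a given field. -/
theorem exists_bellman_data [Fintype Q] (hk : 2 ≤ k) (ha : 0 < a) (s₀ : Q)
    (hW : ScalesBy k a W) (hW0 : ∀ q n, 0 ≤ W q n) (F : Subfield ℝ) (hWF : ∀ q n, W q n ∈ F) :
    ∃ γ ∈ F, 0 ≤ γ ∧ ∃ V : Q → ℕ → ℝ, (∀ q n, V q n ∈ F) ∧ ScalesBy k a V ∧
      (∀ q n i, ∑ i' ∈ Finset.Iio i, W (δ q i') n - γ * i * k ^ n + V (δ q i) n ≤ V q (n + 1)) ∧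
      (∀ q n, ∃ i,
        ∑ i' ∈ Finset.Iio i, W (δ q i') n - γ * i * k ^ n + V (δ q i) n = V q (n + 1)) ∧
      (∀ n (i : Fin k), (i : ℕ) ≠ 0 →
        ∑ i' ∈ Finset.Iio i, W (δ s₀ i') n + V (δ s₀ i) n ≤ γ * i * k ^ n) ∧
      ∃ n, ∃ i : Fin k, (i : ℕ) ≠ 0 ∧
        γ * i * k ^ n ≤ ∑ i' ∈ Finset.Iio i, W (δ s₀ i') n + V (δ s₀ i) n := by
  have hk0 : 0 < k := by omega
  have hk' : (0 : ℝ) < k := by exact_mod_cast hk0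
  set N := (Fintype.card Q + 1) * a with hN
  -- The maximum of this finite set is attained, so `γ` is an explicit loop value and lies in `F`.
  set vals : Set ℝ := {x | ∃ A B j, IsLoopPair δ s₀ a N A B ∧ j < a ∧ x = loopValue δ W s₀ A B j}
  have hfin : vals.Finite := by
    have hl : {w : List (Fin k) | w.length ≤ N}.Finite := List.finite_length_le _ _
    refine (((hl.prod hl).prod (Set.finite_lt_nat a)).image
      fun p => loopValue δ W s₀ p.1.1 p.1.2 p.2).subset ?_
    rintro _ ⟨A, B, j, hAB, hj, rfl⟩
    have := hAB.2.2.2.2.2.1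
    exact ⟨((A, B), j), ⟨⟨by simp; omega, by simp; omega⟩, hj⟩, rfl⟩
  have hne : vals.Nonempty := by
    obtain ⟨A, B, hAB⟩ := exists_isLoopPair δ hk ha s₀ hN.ge
    exact ⟨_, A, B, 0, hAB, ha, rfl⟩
  obtain ⟨γ, hγ⟩ := hfin.exists_maximal hne
  have hgr : ∀ x ∈ vals, x ≤ γ := fun x hx => (le_total x γ).elim id fun hle => hγ.2 hx hle
  have hden : ∀ {A B}, IsLoopPair δ s₀ a N A B →
      (0 : ℝ) < wordVal A + wordVal B / (k ^ B.length - 1) := by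
    intro A B hp
    have h1 := pow_length_sub_one_pos hk hp.2.1
    have h2 : (0 : ℝ) < wordVal A := by exact_mod_cast wordVal_pos_of_head hp.1 hp.2.2.1
    positivity
  obtain ⟨A, B, j, hp, hj, hγe⟩ := hγ.1
  have hpow : ∀ l : ℕ, (k : ℝ) ^ l ∈ F := fun l => pow_mem (natCast_mem F _) _
  have hγF : γ ∈ F := by
    rw [hγe, loopValue]
    have h1 := F.sub_mem (hpow B.length) F.one_mem
    exact F.div_mem (F.add_mem (lexSum_mem δ F hWF _ _ _) (F.div_mem (lexSum_mem δ F hWF _ _ _) h1))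
      (F.mul_mem (F.add_mem (natCast_mem F _) (F.div_mem (natCast_mem F _) h1)) (hpow _))
  have hγ0 : 0 ≤ γ := by
    rw [hγe, loopValue]
    have h1 := pow_length_sub_one_pos hk hp.2.1
    have h2 := lexSum_nonneg (δ := δ) hW0 s₀ j A
    have h3 := lexSum_nonneg (δ := δ) hW0 (A.foldl δ s₀) j B
    have h4 := hden hp
    positivity
  obtain ⟨V, hV, hB, hBe⟩ := exists_bellman δ hk ha hW γ
  refine ⟨γ, hγF, hγ0, V, bellman_mem δ hk ha F hWF hγF hV hB hBe, hV, hB, hBe, ?_, ?_⟩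
  · refine first_letter_le_of_loopPair δ hk ha hN.ge hW hV hB hBe fun A B n hp => ?_
    rw [loopValue_mul hk hp, loopValue_mod hk0 hW]
    have h1 := hgr _ ⟨A, B, n % a, hp, Nat.mod_lt _ ha, rfl⟩
    have h2 := hden hp
    gcongr
  · refine first_letter_ge_of_loopPair δ hk hV hB hp (n := j) ?_
    rw [loopValue_mul hk hp, ← hγe]

/-- Tables of natural numbers that certify the upper mean `g / D`: the means `c / D`, a coboundary
`y / D`, and the solution `(U - b) / D` of the Bellman equation. -/
structure IsCertificate (δ : Q → Fin k → Q) (num den : Q → ℕ) (s₀ : Q) (a D g b : ℕ)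
    (c y U : Q → ℕ → ℕ) : Prop where
  mean_step : ∀ q, ∀ j < a, k * c q (j + 1) = ∑ i, c (δ q i) j
  coboundary_step : ∀ q, ∀ j < a, k * y q (j + 1) = ∑ i, y (δ q i) j
  mean_periodic : ∀ q, c q a = c q 0
  value_periodic : ∀ q, U q a = U q 0
  -- This is `num / den = c / D + (T ^ a y - y) / D` without divisions and subtractions; it
  -- identifies `c / D` as the limit of the means.
  output_eq : ∀ q, D * num q + den q * y q 0 = den q * (c q 0 + y q a)
  -- The terms `k * b` and `b` come from `U - b` taking the place of the possibly negative solution.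
  bellman_le : ∀ q, ∀ j < a, ∀ i,
    ∑ i' ∈ Finset.Iio i, c (δ q i') j + U (δ q i) j + k * b ≤ k * U q (j + 1) + g * i + b
  bellman_eq : ∀ q, ∀ j < a, ∃ i,
    ∑ i' ∈ Finset.Iio i, c (δ q i') j + U (δ q i) j + k * b = k * U q (j + 1) + g * i + b
  first_le : ∀ j < a, ∀ i : Fin k, (i : ℕ) ≠ 0 →
    ∑ i' ∈ Finset.Iio i, c (δ s₀ i') j + U (δ s₀ i) j ≤ g * i + b
  first_ge : ∃ j < a, ∃ i : Fin k, (i : ℕ) ≠ 0 ∧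
    g * i + b ≤ ∑ i' ∈ Finset.Iio i, c (δ s₀ i') j + U (δ s₀ i) j

/-- The sums of `f` over the words of given length. -/
noncomputable def wordSums (δ : Q → Fin k → Q) (f : Q → ℝ) (q : Q) (n : ℕ) : ℝ :=
  k ^ n * (transfer ℝ δ ^ n) f q

theorem isAdditive_wordSums (hk : 0 < k) (δ : Q → Fin k → Q) (f : Q → ℝ) :
    IsAdditive δ (wordSums δ f) := by
  intro q n
  have hk0 : (k : ℝ) ≠ 0 := by exact_mod_cast hk.ne'
  simp only [wordSums]
  rw [pow_succ' (transfer ℝ δ), Module.End.mul_apply, transfer_apply, ← Finset.mul_sum, pow_succ,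
    mul_assoc, mul_inv_cancel_left₀ hk0]

variable {num den : Q → ℕ} {s₀ : Q} {D g b : ℕ} {c y U : Q → ℕ → ℕ}

theorem transfer_pow_eq_of_step (hk : 0 < k) {f : Q → ℕ → ℕ}
    (hf : ∀ q, ∀ j < a, k * f q (j + 1) = ∑ i, f (δ q i) j) (D : ℝ) {j : ℕ} (hj : j ≤ a) (q : Q) :
    (transfer ℝ δ ^ j) (fun q => (f q 0 : ℝ) / D) q = f q j / D := by
  have hk0 : (k : ℝ) ≠ 0 := by exact_mod_cast hk.ne'
  induction j generalizing q with
  | zero => simp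
  | succ j ih =>
    rw [pow_succ' (transfer ℝ δ), Module.End.mul_apply, transfer_apply]
    simp only [ih (Nat.le_of_succ_le hj)]
    have h1 : (k : ℝ) * f q (j + 1) = ∑ i, (f (δ q i) j : ℝ) := by exact_mod_cast hf q j hj
    rw [← Finset.sum_div, ← h1, mul_div_assoc, inv_mul_cancel_left₀ hk0]

/-- A certificate determines the upper mean. -/
theorem IsCertificate.upperMean_eq [Fintype Q] (hk : 2 ≤ k) (ha0 : 0 < a)
    (ha : ∀ i, 1 ≤ i → i ≤ Fintype.card Q → i ∣ a) (hD : D ≠ 0) (hden : ∀ q, den q ≠ 0)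
    (hcert : IsCertificate δ num den s₀ a D g b c y U) {h : ℕ → ℚ≥0}
    (hh : ∀ w : List (Fin k),
      (h (wordVal w) : ℝ) = (num (w.foldl δ s₀) : ℝ) / den (w.foldl δ s₀)) :
    upperMean h = (g : ℝ) / D := by
  have hk0 : 0 < k := by omega
  have hk' : (0 : ℝ) < k := by exact_mod_cast hk0
  have hD' : (0 : ℝ) < D := by exact_mod_cast Nat.pos_of_ne_zero hD
  set S := wordSums δ fun q => (num q : ℝ) / den q
  have hS : IsAdditive δ S := isAdditive_wordSums hk0 δ _
  have hc : ∀ q, ∀ j < a, Tendsto (fun n : ℕ => S q (a * n + j) / (k : ℝ) ^ (a * n + j)) atTop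
      (𝓝 ((c q j : ℝ) / D)) := by
    intro q j hj
    rw [← transfer_pow_eq_of_step hk0 hcert.mean_step (D : ℝ) hj.le]
    refine hS.tendsto_of_decomposition δ hk0 ha0 ha (y := fun q => (y q 0 : ℝ) / D) ?_ ?_ q j
    · funext q
      rw [transfer_pow_eq_of_step hk0 hcert.mean_step (D : ℝ) le_rfl, hcert.mean_periodic]
    · funext q
      simp only [Pi.add_apply, Pi.sub_apply]
      rw [transfer_pow_eq_of_step hk0 hcert.coboundary_step (D : ℝ) le_rfl]
      have h1 : (D : ℝ) * num q + den q * y q 0 = den q * (c q 0 + y q a) := by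
        exact_mod_cast hcert.output_eq q
      have h2 : (den q : ℝ) ≠ 0 := by exact_mod_cast hden q
      simp only [S, wordSums, pow_zero, one_mul, Module.End.one_apply]
      field_simp
      linarith
  have hmod : ∀ n, n % a < a := fun n => Nat.mod_lt n ha0
  -- At the end of a period the index wraps from `a` to `0`, where the table entries agree.
  have hU : ∀ q n, U q ((n + 1) % a) = U q (n % a + 1) := by
    intro q n
    rw [← Nat.mod_add_mod]
    rcases (show n % a + 1 ≤ a from hmod n).lt_or_eq with hlt | heq
    · rw [Nat.mod_eq_of_lt hlt]
    · rw [heq, Nat.mod_self, hcert.value_periodic]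
  refine upperMean_eq_of_bellman δ (s₀ := s₀) (S := S) (W := periodicWeight k a fun q j => (c q j : ℝ) / D)
    (V := periodicWeight k a fun q j => ((U q j : ℝ) - b) / D) hk ha0 hS (fun w => ?_)
    (exists_forall_abs_sub_periodicWeight_le hk0 ha0 hc) (scalesBy_periodicWeight _ _ _)
    (scalesBy_periodicWeight _ _ _) (by positivity) (fun q n i => ?_) (fun q n => ?_)
    (fun n i hi => ?_) ?_
  · rw [hh]
    simp [S, wordSums]
  · have h1 : (∑ i' ∈ Finset.Iio i, (c (δ q i') (n % a) : ℝ)) + U (δ q i) (n % a) + k * b ≤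
        k * U q (n % a + 1) + g * i + b := by exact_mod_cast hcert.bellman_le q _ (hmod n) i
    simp only [periodicWeight, hU, ← Finset.mul_sum, ← Finset.sum_div]
    rw [pow_succ, mul_assoc ((k : ℝ) ^ n) (k : ℝ)]
    have h2 : (k : ℝ) ^ n * ((∑ i' ∈ Finset.Iio i, (c (δ q i') (n % a) : ℝ)) / D) -
        g / D * i * k ^ n + k ^ n * ((U (δ q i) (n % a) - b) / D) =
        k ^ n * (((∑ i' ∈ Finset.Iio i, (c (δ q i') (n % a) : ℝ)) - g * i +
          (U (δ q i) (n % a) - b)) / D) := by ring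
    rw [h2, ← mul_div_assoc (k : ℝ)]
    gcongr
    linarith
  · obtain ⟨i, hi⟩ := hcert.bellman_eq q _ (hmod n)
    refine ⟨i, ?_⟩
    have h1 : (∑ i' ∈ Finset.Iio i, (c (δ q i') (n % a) : ℝ)) + U (δ q i) (n % a) + k * b =
        k * U q (n % a + 1) + g * i + b := by exact_mod_cast hi
    simp only [periodicWeight, hU, ← Finset.mul_sum, ← Finset.sum_div]
    rw [pow_succ, mul_assoc ((k : ℝ) ^ n) (k : ℝ)]
    have h2 : (k : ℝ) ^ n * ((∑ i' ∈ Finset.Iio i, (c (δ q i') (n % a) : ℝ)) / D) -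
        g / D * i * k ^ n + k ^ n * ((U (δ q i) (n % a) - b) / D) =
        k ^ n * (((∑ i' ∈ Finset.Iio i, (c (δ q i') (n % a) : ℝ)) - g * i +
          (U (δ q i) (n % a) - b)) / D) := by ring
    rw [h2, ← mul_div_assoc (k : ℝ)]
    congr 2
    linarith
  · have h1 : (∑ i' ∈ Finset.Iio i, (c (δ s₀ i') (n % a) : ℝ)) + U (δ s₀ i) (n % a) ≤
        g * i + b := by exact_mod_cast hcert.first_le _ (hmod n) i hi
    simp only [periodicWeight, ← Finset.mul_sum, ← Finset.sum_div]
    have h2 : (g : ℝ) / D * i * k ^ n = k ^ n * (g * i / D) := by ring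
    rw [h2, ← mul_add, ← add_div]
    gcongr
    linarith
  · obtain ⟨j, hj, i, hi, hle⟩ := hcert.first_ge
    refine ⟨j, i, hi, ?_⟩
    have h1 : (g : ℝ) * i + b ≤ (∑ i' ∈ Finset.Iio i, (c (δ s₀ i') j : ℝ)) + U (δ s₀ i) j := by
      exact_mod_cast hle
    simp only [periodicWeight, ← Finset.mul_sum, ← Finset.sum_div, Nat.mod_eq_of_lt hj]
    have h2 : (g : ℝ) / D * i * k ^ j = k ^ j * (g * i / D) := by ring
    rw [h2, ← mul_add, ← add_div]
    gcongr
    linarith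

theorem exists_common_denominator {s : Set ℚ} (hs : s.Finite) (h0 : ∀ x ∈ s, 0 ≤ x) :
    ∃ D : ℕ, D ≠ 0 ∧ ∀ x ∈ s, (⌊x * D⌋₊ : ℚ) = x * D := by
  refine ⟨∏ x ∈ hs.toFinset, x.den, Finset.prod_ne_zero_iff.2 fun x _ => x.den_ne_zero,
    fun x hx => ?_⟩
  obtain ⟨e, he⟩ := Finset.dvd_prod_of_mem (fun x : ℚ => x.den) (hs.mem_toFinset.2 hx)
  obtain ⟨n, hn⟩ := Int.eq_ofNat_of_zero_le (Rat.num_nonneg.2 (h0 x hx))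
  have h1 : x * (∏ x ∈ hs.toFinset, x.den : ℕ) = (n * e : ℕ) := by
    rw [he]
    push_cast
    rw [← mul_assoc, Rat.mul_den_eq_num, hn]
    simp
  rw [h1, Nat.floor_natCast]

/-- Every system has a certificate. -/
theorem exists_isCertificate [Fintype Q] (hk : 2 ≤ k) (δ : Q → Fin k → Q) (num den : Q → ℕ)
    (s₀ : Q) (hden : ∀ q, den q ≠ 0) (ha0 : 0 < a) (ha : ∀ i, 1 ≤ i → i ≤ Fintype.card Q → i ∣ a) :
    ∃ D g b c y U, D ≠ 0 ∧ IsCertificate δ num den s₀ a D g b c y U := by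
  have hk0 : 0 < k := by omega
  have hk' : (0 : ℝ) < k := by exact_mod_cast hk0
  have hkQ : (k : ℚ) ≠ 0 := by exact_mod_cast hk0.ne'
  obtain ⟨p, y₀, hp, hv⟩ := exists_decomposition δ a fun q => (num q : ℚ) / den q
  have hcast : ∀ n (f : Q → ℚ) q, ((transfer ℚ δ ^ n) f q : ℝ) =
      (transfer ℝ δ ^ n) (fun q => (f q : ℝ)) q :=
    fun n f q => transfer_pow_map (Rat.castHom ℝ) δ n f q
  have hpow : ∀ (f : Q → ℚ) q j, (k : ℚ) * (transfer ℚ δ ^ (j + 1)) f q =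
      ∑ i, (transfer ℚ δ ^ j) f (δ q i) := by
    intro f q j
    rw [pow_succ' (transfer ℚ δ), Module.End.mul_apply, transfer_apply, mul_inv_cancel_left₀ hkQ]
  -- the means
  set S := wordSums δ fun q => (num q : ℝ) / den q
  have hS : IsAdditive δ S := isAdditive_wordSums hk0 δ _
  set cQ : Q → ℕ → ℚ := fun q j => (transfer ℚ δ ^ j) p q with hcQ
  have hlim : ∀ q j, Tendsto (fun n : ℕ => S q (a * n + j) / (k : ℝ) ^ (a * n + j)) atTop
      (𝓝 (cQ q j : ℝ)) := by
    intro q j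
    simp only [hcQ, hcast]
    refine hS.tendsto_of_decomposition δ hk0 ha0 ha (y := fun q => (y₀ q : ℝ)) ?_ ?_ q j
    · funext q
      rw [← hcast, hp]
    · funext q
      have := congrArg (Rat.cast : ℚ → ℝ) (congrFun hv q)
      simp only [Pi.add_apply, Pi.sub_apply] at this ⊢
      rw [← hcast]
      push_cast at this
      simpa [S, wordSums] using this
  have hS0 : ∀ n q, 0 ≤ S q n := by
    intro n
    induction n with
    | zero =>
      intro q
      simp only [S, wordSums, pow_zero, one_mul, Module.End.one_apply]
      positivity
    | succ n ih =>
      intro q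
      rw [hS]
      exact Finset.sum_nonneg fun i _ => ih _
  have hc0 : ∀ q j, 0 ≤ cQ q j := fun q j => by
    have := ge_of_tendsto' (hlim q j) (b := (0 : ℝ)) fun n => div_nonneg (hS0 _ _) (by positivity)
    exact_mod_cast this
  have hca : ∀ q, cQ q a = cQ q 0 := fun q => by simp [hcQ, hp]
  -- the coboundary, made nonnegative
  obtain ⟨Y, hY⟩ : ∃ Y : ℚ, ∀ q, ∀ j ≤ a, 0 ≤ (transfer ℚ δ ^ j) y₀ q + Y := by
    obtain ⟨Y, hY⟩ := (Set.finite_range fun x : Q × Fin (a + 1) =>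
      -(transfer ℚ δ ^ (x.2 : ℕ)) y₀ x.1).bddAbove
    refine ⟨Y, fun q j hj => ?_⟩
    have := hY ⟨(q, ⟨j, Nat.lt_succ_of_le hj⟩), rfl⟩
    simp only at this
    linarith
  set yQ : Q → ℕ → ℚ := fun q j => (transfer ℚ δ ^ j) y₀ q + Y with hyQ
  -- the solution of the Bellman equation
  set W := periodicWeight k a fun q j => (cQ q j : ℝ) with hWdef
  -- The subfield is the image of `ℚ`, so the solution found by a contraction over `ℝ` turns out to
  -- be rational.
  obtain ⟨γ, ⟨γ', rfl⟩, hγ0, V, hVF, hV, hB, hBe, hF, hFe⟩ := exists_bellman_data (δ := δ) (W := W) hk ha0 s₀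
    (scalesBy_periodicWeight _ _ _)
    (fun q n => mul_nonneg (by positivity) (Rat.cast_nonneg.2 (hc0 q _)))
    (Rat.castHom ℝ).fieldRange
    (fun q n => ⟨k ^ n * cQ q (n % a), by simp [hWdef, periodicWeight]⟩)
  choose VQ hVQ using hVF
  simp only [eq_ratCast] at hVQ hγ0 hB hBe hF hFe
  set vQ : Q → ℕ → ℚ := fun q j => VQ q j / k ^ j with hvQ
  have hVv : ∀ q j, V q j = k ^ j * (vQ q j : ℝ) := by
    intro q j
    rw [← hVQ, hvQ]
    push_cast
    field_simp
  have hWj : ∀ q, ∀ j < a, W q j = k ^ j * (cQ q j : ℝ) := by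
    intro q j hj
    rw [hWdef, periodicWeight, Nat.mod_eq_of_lt hj]
  obtain ⟨Z, hZ0, hZ⟩ : ∃ Z : ℚ, 0 ≤ Z ∧ ∀ q, ∀ j ≤ a, 0 ≤ vQ q j + Z := by
    obtain ⟨Z, hZ⟩ := (Set.finite_range fun x : Q × Fin (a + 1) => -vQ x.1 x.2).bddAbove
    refine ⟨max Z 0, le_max_right _ _, fun q j hj => ?_⟩
    have := hZ ⟨(q, ⟨j, Nat.lt_succ_of_le hj⟩), rfl⟩
    have h2 := le_max_left Z 0
    simp only at this
    linarith
  have hva : ∀ q, vQ q a = vQ q 0 := by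
    intro q
    have h1 := hV q 0
    rw [zero_add, hVv, hVv, pow_zero, one_mul] at h1
    exact_mod_cast mul_left_cancel₀ (by positivity) h1
  have hγ0' : 0 ≤ γ' := by exact_mod_cast hγ0
  -- the identities over the rationals
  have hsumW : ∀ q, ∀ j < a, ∀ i : Fin k, ∑ i' ∈ Finset.Iio i, W (δ q i') j =
      k ^ j * ((∑ i' ∈ Finset.Iio i, cQ (δ q i') j : ℚ) : ℝ) := by
    intro q j hj i
    push_cast
    rw [Finset.mul_sum]
    exact Finset.sum_congr rfl fun i' _ => hWj _ j hj
  have hlhs : ∀ q, ∀ j < a, ∀ i : Fin k,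
      ∑ i' ∈ Finset.Iio i, W (δ q i') j - (γ' : ℝ) * i * k ^ j + V (δ q i) j =
      k ^ j * ((∑ i' ∈ Finset.Iio i, cQ (δ q i') j - γ' * i + vQ (δ q i) j : ℚ) : ℝ) := by
    intro q j hj i
    rw [hsumW q j hj, hVv]
    push_cast
    ring
  have hrhs : ∀ q j, V q (j + 1) = k ^ j * ((k * vQ q (j + 1) : ℚ) : ℝ) := by
    intro q j
    rw [hVv]
    push_cast
    ring
  have hBQ : ∀ q, ∀ j < a, ∀ i,
      ∑ i' ∈ Finset.Iio i, cQ (δ q i') j - γ' * i + vQ (δ q i) j ≤ k * vQ q (j + 1) := by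
    intro q j hj i
    have h1 := hB q j i
    rw [hlhs q j hj, hrhs] at h1
    exact_mod_cast le_of_mul_le_mul_left h1 (by positivity)
  have hBeQ : ∀ q, ∀ j < a, ∃ i : Fin k,
      ∑ i' ∈ Finset.Iio i, cQ (δ q i') j - γ' * i + vQ (δ q i) j = k * vQ q (j + 1) := by
    intro q j hj
    obtain ⟨i, h1⟩ := hBe q j
    refine ⟨i, ?_⟩
    rw [hlhs q j hj, hrhs] at h1
    exact_mod_cast mul_left_cancel₀ (by positivity) h1
  have hFl : ∀ j < a, ∀ i : Fin k, ∑ i' ∈ Finset.Iio i, W (δ s₀ i') j + V (δ s₀ i) j =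
      k ^ j * ((∑ i' ∈ Finset.Iio i, cQ (δ s₀ i') j + vQ (δ s₀ i) j : ℚ) : ℝ) := by
    intro j hj i
    rw [hsumW s₀ j hj, hVv]
    push_cast
    ring
  have hFr : ∀ j (i : Fin k), (γ' : ℝ) * i * k ^ j = k ^ j * ((γ' * i : ℚ) : ℝ) := by
    intro j i
    push_cast
    ring
  have hFQ : ∀ j < a, ∀ i : Fin k, (i : ℕ) ≠ 0 →
      ∑ i' ∈ Finset.Iio i, cQ (δ s₀ i') j + vQ (δ s₀ i) j ≤ γ' * i := by
    intro j hj i hi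
    have h1 := hF j i hi
    rw [hFl j hj, hFr] at h1
    exact_mod_cast le_of_mul_le_mul_left h1 (by positivity)
  have hFeQ : ∃ j < a, ∃ i : Fin k, (i : ℕ) ≠ 0 ∧
      γ' * i ≤ ∑ i' ∈ Finset.Iio i, cQ (δ s₀ i') j + vQ (δ s₀ i) j := by
    obtain ⟨n, i, hi, h1⟩ := hFe
    have hj := Nat.mod_lt n ha0
    refine ⟨n % a, hj, i, hi, ?_⟩
    have hd : a ∣ a * (n / a) := Dvd.intro _ rfl
    have hWs := fun q => (scalesBy_periodicWeight k a fun q j => (cQ q j : ℝ)).of_dvd hd q (n % a)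
    have hVs := fun q => hV.of_dvd hd q (n % a)
    rw [Nat.mod_add_div] at hWs hVs
    rw [hVs, Finset.sum_congr rfl fun i' _ => hWs (δ s₀ i'), ← Finset.mul_sum, ← mul_add] at h1
    have h2 : (k : ℝ) ^ n = k ^ (a * (n / a)) * k ^ (n % a) := by
      rw [← pow_add, Nat.div_add_mod]
    rw [h2, mul_left_comm] at h1
    have h3 := le_of_mul_le_mul_left h1 (by positivity)
    rw [← hWdef, hFl _ hj, hFr] at h3
    exact_mod_cast le_of_mul_le_mul_left h3 (by positivity)
  -- clearing denominators
  set s : Set ℚ := (Set.range fun x : Q × Fin (a + 1) => cQ x.1 x.2) ∪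
    ((Set.range fun x : Q × Fin (a + 1) => yQ x.1 x.2) ∪
    ((Set.range fun x : Q × Fin (a + 1) => vQ x.1 x.2 + Z) ∪ {γ', Z})) with hs
  have hsfin : s.Finite := (Set.finite_range _).union ((Set.finite_range _).union
    ((Set.finite_range _).union (by simp)))
  obtain ⟨D, hD, hfloor⟩ := exists_common_denominator hsfin (by
    rintro x (⟨x, rfl⟩ | ⟨x, rfl⟩ | ⟨x, rfl⟩ | rfl | rfl)
    · exact hc0 _ _
    · exact hY _ _ (Nat.le_of_lt_succ x.2.2)
    · exact hZ _ _ (Nat.le_of_lt_succ x.2.2)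
    · exact hγ0'
    · exact hZ0)
  have hcD : ∀ q, ∀ j ≤ a, (⌊cQ q j * D⌋₊ : ℚ) = cQ q j * D := fun q j hj =>
    hfloor _ (Or.inl ⟨(q, ⟨j, Nat.lt_succ_of_le hj⟩), rfl⟩)
  have hyD : ∀ q, ∀ j ≤ a, (⌊yQ q j * D⌋₊ : ℚ) = yQ q j * D := fun q j hj =>
    hfloor _ (Or.inr (Or.inl ⟨(q, ⟨j, Nat.lt_succ_of_le hj⟩), rfl⟩))
  have hvD : ∀ q, ∀ j ≤ a, (⌊(vQ q j + Z) * D⌋₊ : ℚ) = (vQ q j + Z) * D := fun q j hj =>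
    hfloor _ (Or.inr (Or.inr (Or.inl ⟨(q, ⟨j, Nat.lt_succ_of_le hj⟩), rfl⟩)))
  have hγD : (⌊γ' * D⌋₊ : ℚ) = γ' * D := hfloor _ (by simp [hs])
  have hZD : (⌊Z * D⌋₊ : ℚ) = Z * D := hfloor _ (by simp [hs])
  have hD0 : (0 : ℚ) ≤ D := by positivity
  have hsumD : ∀ q, ∀ j < a, ∀ i : Fin k,
      ((∑ i' ∈ Finset.Iio i, ⌊cQ (δ q i') j * D⌋₊ : ℕ) : ℚ) =
      (∑ i' ∈ Finset.Iio i, cQ (δ q i') j) * D := by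
    intro q j hj i
    push_cast
    rw [Finset.sum_mul]
    exact Finset.sum_congr rfl fun i' _ => hcD _ j hj.le
  refine ⟨D, ⌊γ' * D⌋₊, ⌊Z * D⌋₊, fun q j => ⌊cQ q j * D⌋₊, fun q j => ⌊yQ q j * D⌋₊,
    fun q j => ⌊(vQ q j + Z) * D⌋₊, hD, ?_, ?_, fun q => ?_, fun q => ?_, fun q => ?_,
    fun q j hj i => ?_, fun q j hj => ?_, fun j hj i hi => ?_, ?_⟩
  · intro q j hj
    have h1 : (k : ℚ) * cQ q (j + 1) = ∑ i, cQ (δ q i) j := hpow p q j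
    rw [← Nat.cast_inj (R := ℚ)]
    push_cast
    rw [hcD _ _ (show j + 1 ≤ a from hj), Finset.sum_congr rfl fun i _ => hcD (δ q i) j hj.le, ← Finset.sum_mul, ← h1]
    ring
  · intro q j hj
    -- Adding the constant `Y` preserves the recursion because averaging fixes constants.
    have h1 : (k : ℚ) * yQ q (j + 1) = ∑ i, yQ (δ q i) j := by
      simp only [hyQ, mul_add, hpow, Finset.sum_add_distrib]
      simp
    rw [← Nat.cast_inj (R := ℚ)]
    push_cast
    rw [hyD _ _ (show j + 1 ≤ a from hj), Finset.sum_congr rfl fun i _ => hyD (δ q i) j hj.le, ← Finset.sum_mul, ← h1]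
    ring
  · rw [hca]
  · rw [hva]
  · rw [← Nat.cast_inj (R := ℚ)]
    push_cast
    rw [hyD _ _ ha0.le, hyD _ _ le_rfl, hcD _ _ ha0.le]
    have h1 := congrFun hv q
    have h2 : (den q : ℚ) ≠ 0 := by exact_mod_cast hden q
    simp only [Pi.add_apply, Pi.sub_apply] at h1
    rw [div_eq_iff h2] at h1
    simp only [hcQ, hyQ, pow_zero, Module.End.one_apply]
    rw [h1]
    ring
  · rw [← Nat.cast_le (α := ℚ)]
    rw [Nat.cast_add, Nat.cast_add, hsumD q j hj]
    push_cast
    rw [hvD _ _ (show j + 1 ≤ a from hj), hvD _ _ hj.le, hγD, hZD]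
    have := mul_le_mul_of_nonneg_right (hBQ q j hj i) hD0
    linarith
  · obtain ⟨i, hi⟩ := hBeQ q j hj
    refine ⟨i, ?_⟩
    rw [← Nat.cast_inj (R := ℚ)]
    rw [Nat.cast_add, Nat.cast_add, hsumD q j hj]
    push_cast
    rw [hvD _ _ (show j + 1 ≤ a from hj), hvD _ _ hj.le, hγD, hZD]
    have := congrArg (fun x : ℚ => x * D) hi
    linarith
  · rw [← Nat.cast_le (α := ℚ)]
    rw [Nat.cast_add, hsumD s₀ j hj]
    push_cast
    rw [hvD _ _ hj.le, hγD, hZD]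
    have := mul_le_mul_of_nonneg_right (hFQ j hj i hi) hD0
    linarith
  · obtain ⟨j, hj, i, hi, hle⟩ := hFeQ
    refine ⟨j, hj, i, hi, ?_⟩
    rw [← Nat.cast_le (α := ℚ)]
    rw [Nat.cast_add, Nat.cast_add, hsumD s₀ j hj]
    push_cast
    rw [hvD _ _ hj.le, hγD, hZD]
    have := mul_le_mul_of_nonneg_right hle hD0
    linarith

end Certificates

/-! ### Primitive recursive bounded quantifiers and sums -/

section PrimrecTools

variable {α : Type} [Primcodable α]

theorem PrimrecPred.forall_lt_of {f : α → ℕ} {p : α → ℕ → Prop} (hf : Primrec f)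
    (hp : PrimrecPred fun z : α × ℕ => p z.1 z.2) : PrimrecPred fun x => ∀ i < f x, p x i := by
  have h1 : PrimrecRel fun (i : ℕ) (x : α) => p x i :=
    PrimrecPred.primrecRel (p := fun z : ℕ × α => p z.2 z.1)
      (hp.comp (Primrec.snd.pair Primrec.fst))
  exact ((PrimrecRel.forall_mem_list h1).comp (Primrec.list_range.comp hf) Primrec.id).of_eq
    fun x => by simp

theorem PrimrecPred.exists_lt_of {f : α → ℕ} {p : α → ℕ → Prop} (hf : Primrec f)
    (hp : PrimrecPred fun z : α × ℕ => p z.1 z.2) : PrimrecPred fun x => ∃ i < f x, p x i := by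
  have h1 : PrimrecRel fun (i : ℕ) (x : α) => p x i :=
    PrimrecPred.primrecRel (p := fun z : ℕ × α => p z.2 z.1)
      (hp.comp (Primrec.snd.pair Primrec.fst))
  exact ((PrimrecRel.exists_mem_list h1).comp (Primrec.list_range.comp hf) Primrec.id).of_eq
    fun x => by simp

theorem Primrec.sum_range {f : α → ℕ} {g : α → ℕ → ℕ} (hf : Primrec f)
    (hg : Primrec fun z : α × ℕ => g z.1 z.2) :
    Primrec fun x => ∑ i ∈ Finset.range (f x), g x i := by
  have h : Primrec₂ fun (x : α) (p : ℕ × ℕ) => p.2 + g x p.1 :=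
    Primrec.nat_add.comp (Primrec.snd.comp Primrec.snd)
      (hg.comp (Primrec.fst.pair (Primrec.fst.comp Primrec.snd)))
  refine (Primrec.nat_rec' hf (Primrec.const 0) h).of_eq fun x => ?_
  induction f x with
  | zero => simp
  | succ n ih => simp [Finset.sum_range_succ, ← ih]

end PrimrecTools

/-! ### Numerical descriptions of automata -/

namespace DFAOCode

/-- The base of a description, at least two. -/
def base (x : DFAOCode) : ℕ := max x.1 2

/-- The transitions on the states `0, …, m` of the automaton that reads words with leading zeros; its
initial state is `m`, and table entries that are too large are cut off. -/
def step (x : DFAOCode) (q i : ℕ) : ℕ :=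
  if q = x.2.1 ∧ i = 0 then x.2.1
  else min (((x.2.2.2.1.getD (if q = x.2.1 then x.2.2.1 else q) []).getD i 0)) x.2.1

/-- The output of a state as a pair of numbers. -/
def outPair (x : DFAOCode) (q : ℕ) : ℕ × ℕ :=
  x.2.2.2.2.getD (if q = x.2.1 then x.2.2.1 else q) (0, 0)

/-- The numerator of the output of a state. -/
def num (x : DFAOCode) (q : ℕ) : ℕ := (x.outPair q).1

/-- The denominator of the output of a state, at least one. -/
def den (x : DFAOCode) (q : ℕ) : ℕ := max (x.outPair q).2 1

/-- The cut-off makes even a malformed description define a transition system, so that the search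
can terminate on every input. -/
theorem step_le (x : DFAOCode) (q i : ℕ) : x.step q i ≤ x.2.1 := by
  rw [step]
  split
  · exact le_rfl
  · exact min_le_right _ _

variable {α : Type} [Primcodable α]

theorem primrec_base {x : α → DFAOCode} (hx : Primrec x) : Primrec fun t => (x t).base :=
  Primrec.nat_max.comp (Primrec.fst.comp hx) (Primrec.const 2)

theorem primrec_states {x : α → DFAOCode} (hx : Primrec x) : Primrec fun t => (x t).2.1 :=
  Primrec.fst.comp (Primrec.snd.comp hx)

theorem primrec_row {x : α → DFAOCode} {q : α → ℕ} (hx : Primrec x) (hq : Primrec q) :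
    Primrec fun t => if q t = (x t).2.1 then (x t).2.2.1 else q t :=
  Primrec.ite (Primrec.eq.comp hq (primrec_states hx))
    (Primrec.fst.comp (Primrec.snd.comp (Primrec.snd.comp hx))) hq

theorem primrec_step {x : α → DFAOCode} {q i : α → ℕ} (hx : Primrec x) (hq : Primrec q)
    (hi : Primrec i) : Primrec fun t => (x t).step (q t) (i t) := by
  have htab : Primrec fun t => (x t).2.2.2.1 :=
    Primrec.fst.comp (Primrec.snd.comp (Primrec.snd.comp (Primrec.snd.comp hx)))
  exact Primrec.ite
    ((Primrec.eq.comp hq (primrec_states hx)).and (Primrec.eq.comp hi (Primrec.const 0)))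
    (primrec_states hx)
    (Primrec.nat_min.comp ((Primrec.list_getD 0).comp
      ((Primrec.list_getD []).comp htab (primrec_row hx hq)) hi) (primrec_states hx))

theorem primrec_outPair {x : α → DFAOCode} {q : α → ℕ} (hx : Primrec x) (hq : Primrec q) :
    Primrec fun t => (x t).outPair (q t) :=
  (Primrec.list_getD (0, 0)).comp
    (Primrec.snd.comp (Primrec.snd.comp (Primrec.snd.comp (Primrec.snd.comp hx))))
    (primrec_row hx hq)

theorem primrec_num {x : α → DFAOCode} {q : α → ℕ} (hx : Primrec x) (hq : Primrec q) :
    Primrec fun t => (x t).num (q t) :=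
  Primrec.fst.comp (primrec_outPair hx hq)

theorem primrec_den {x : α → DFAOCode} {q : α → ℕ} (hx : Primrec x) (hq : Primrec q) :
    Primrec fun t => (x t).den (q t) :=
  Primrec.nat_max.comp (Primrec.snd.comp (primrec_outPair hx hq)) (Primrec.const 1)

/-- The transition function of a description. -/
def fstep (x : DFAOCode) (q : Fin (x.2.1 + 1)) (i : Fin x.base) : Fin (x.2.1 + 1) :=
  ⟨x.step q i, Nat.lt_succ_of_le (x.step_le q i)⟩

end DFAOCode

/-! ### Encoded certificates -/

/-- Finite certificates: the period, the common denominator, the numerator of the upper mean, the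
shift of the solution of the Bellman equation, and three tables. -/
abbrev CertCode : Type := (ℕ × ℕ × ℕ × ℕ) × (List ℕ × List ℕ × List ℕ)

namespace CertCode

/-- The entry for the state `q` and the index `j ≤ a` of a table. -/
def entry (a : ℕ) (l : List ℕ) (q j : ℕ) : ℕ := l.getD (q * (a + 1) + j) 0

theorem exists_entry_eq (a m : ℕ) (f : Fin m → ℕ → ℕ) :
    ∃ l, ∀ q : Fin m, ∀ j ≤ a, entry a l q j = f q j := by
  refine ⟨(List.range (m * (a + 1))).map fun t =>
    if h : t / (a + 1) < m then f ⟨t / (a + 1), h⟩ (t % (a + 1)) else 0, fun q j hj => ?_⟩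
  have h1 : (q : ℕ) * (a + 1) + j < m * (a + 1) := by
    have := Nat.mul_le_mul_right (a + 1) (Nat.succ_le_of_lt q.2)
    rw [Nat.succ_mul] at this
    omega
  have h2 : ((q : ℕ) * (a + 1) + j) / (a + 1) = q := by
    rw [mul_comm, Nat.mul_add_div (by omega), Nat.div_eq_of_lt (by omega), add_zero]
  have h3 : ((q : ℕ) * (a + 1) + j) % (a + 1) = j := by
    rw [mul_comm, Nat.mul_add_mod, Nat.mod_eq_of_lt (by omega)]
  rw [entry, List.getD_eq_getElem _ _ (by simpa using h1)]
  simp [h2, h3]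

variable (x : DFAOCode) (z : CertCode)

/-- The period. -/
def period : ℕ := z.1.1
/-- The common denominator. -/
def denom : ℕ := z.1.2.1
/-- The numerator of the upper mean. -/
def numer : ℕ := z.1.2.2.1
/-- The shift of the solution of the Bellman equation. -/
def shift : ℕ := z.1.2.2.2
/-- The table of the means. -/
def mean (q j : ℕ) : ℕ := entry z.period z.2.1 q j
/-- The table of the coboundary. -/
def cobd (q j : ℕ) : ℕ := entry z.period z.2.2.1 q j
/-- The table of the solution of the Bellman equation. -/
def value (q j : ℕ) : ℕ := entry z.period z.2.2.2 q j

/-- The left side of the Bellman inequality. -/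
def reward (q j i : ℕ) : ℕ :=
  ∑ i' ∈ Finset.range i, z.mean (x.step q i') j + z.value (x.step q i) j

/-- Validity of a certificate for a description. -/
def Valid : Prop :=
  ((z.denom ≠ 0 ∧ z.period ≠ 0 ∧ ∀ i < x.2.1 + 1, z.period % (i + 1) = 0) ∧
    ∀ q < x.2.1 + 1,
      z.mean q z.period = z.mean q 0 ∧ z.value q z.period = z.value q 0 ∧
      z.denom * x.num q + x.den q * z.cobd q 0 = x.den q * (z.mean q 0 + z.cobd q z.period)) ∧
  (∀ q < x.2.1 + 1, ∀ j < z.period,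
    (x.base * z.mean q (j + 1) = ∑ i ∈ Finset.range x.base, z.mean (x.step q i) j ∧
      x.base * z.cobd q (j + 1) = ∑ i ∈ Finset.range x.base, z.cobd (x.step q i) j) ∧
    (∀ i < x.base, z.reward x q j i + x.base * z.shift ≤
      x.base * z.value q (j + 1) + z.numer * i + z.shift) ∧
    ∃ i < x.base, z.reward x q j i + x.base * z.shift =
      x.base * z.value q (j + 1) + z.numer * i + z.shift) ∧
  (∀ j < z.period, ∀ i < x.base, i = 0 ∨ z.reward x x.2.1 j i ≤ z.numer * i + z.shift) ∧
  ∃ j < z.period, ∃ i < x.base, i ≠ 0 ∧ z.numer * i + z.shift ≤ z.reward x x.2.1 j i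

variable {x z}

/-- `Valid` quantifies over bounded natural numbers in place of `Fin`, which makes it accessible to
primitive recursion. -/
theorem valid_iff : z.Valid x ↔ (z.denom ≠ 0 ∧ z.period ≠ 0 ∧
    ∀ i, 1 ≤ i → i ≤ Fintype.card (Fin (x.2.1 + 1)) → i ∣ z.period) ∧
    IsCertificate x.fstep (fun q => x.num q) (fun q => x.den q) (Fin.last x.2.1) z.period z.denom
      z.numer z.shift (fun q => z.mean q) (fun q => z.cobd q) (fun q => z.value q) := by
  have hsum : ∀ (q : Fin (x.2.1 + 1)) (f : ℕ → ℕ → ℕ) j,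
      ∑ i, f (x.fstep q i) j = ∑ i ∈ Finset.range x.base, f (x.step q i) j := fun q f j =>
    Fin.sum_univ_eq_sum_range (fun i => f (x.step q i) j) x.base
  have hrew : ∀ (q : Fin (x.2.1 + 1)) j (i : Fin x.base),
      ∑ i' ∈ Finset.Iio i, z.mean (x.fstep q i') j + z.value (x.fstep q i) j =
        z.reward x q j i := fun q j i => by
    rw [reward, ← sum_fin_Iio_eq_sum_range i fun i' => z.mean (x.step q i') j]
    rfl
  constructor
  · rintro ⟨⟨⟨hD, ha, hd⟩, h1⟩, h2, h3, j₀, hj₀, i₀, hi₀, h4⟩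
    refine ⟨⟨hD, ha, fun i hi hi' => ?_⟩, ?_⟩
    · rw [Fintype.card_fin] at hi'
      have := hd (i - 1) (by omega)
      rw [Nat.sub_add_cancel hi] at this
      exact Nat.dvd_of_mod_eq_zero this
    · constructor
      · intro q j hj
        rw [hsum q z.mean]
        exact (h2 q q.2 j hj).1.1
      · intro q j hj
        rw [hsum q z.cobd]
        exact (h2 q q.2 j hj).1.2
      · exact fun q => (h1 q q.2).1
      · exact fun q => (h1 q q.2).2.1
      · exact fun q => (h1 q q.2).2.2
      · intro q j hj i
        rw [hrew]
        exact (h2 q q.2 j hj).2.1 i i.2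
      · intro q j hj
        obtain ⟨i, hi, h⟩ := (h2 q q.2 j hj).2.2
        refine ⟨⟨i, hi⟩, ?_⟩
        rw [hrew]
        exact h
      · intro j hj i hi
        rw [hrew]
        exact (h3 j hj i i.2).resolve_left hi
      · refine ⟨j₀, hj₀, ⟨i₀, hi₀⟩, h4.1, ?_⟩
        rw [hrew]
        exact h4.2
  · rintro ⟨⟨hD, ha, hd⟩, hc⟩
    refine ⟨⟨⟨hD, ha, fun i hi => ?_⟩, fun q hq => ?_⟩, fun q hq j hj => ?_, fun j hj i hi => ?_, ?_⟩
    · exact Nat.mod_eq_zero_of_dvd (hd (i + 1) (by omega) (by rw [Fintype.card_fin]; omega))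
    · exact ⟨hc.mean_periodic ⟨q, hq⟩, hc.value_periodic ⟨q, hq⟩, hc.output_eq ⟨q, hq⟩⟩
    · have h1 := hc.mean_step ⟨q, hq⟩ j hj
      have h2 := hc.coboundary_step ⟨q, hq⟩ j hj
      rw [hsum ⟨q, hq⟩ z.mean] at h1
      rw [hsum ⟨q, hq⟩ z.cobd] at h2
      refine ⟨⟨h1, h2⟩, fun i hi => ?_, ?_⟩
      · have := hc.bellman_le ⟨q, hq⟩ j hj ⟨i, hi⟩
        rwa [hrew] at this
      · obtain ⟨i, hi⟩ := hc.bellman_eq ⟨q, hq⟩ j hj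
        rw [hrew] at hi
        exact ⟨i, i.2, hi⟩
    · by_cases hi0 : i = 0
      · exact Or.inl hi0
      · have := hc.first_le j hj ⟨i, hi⟩ hi0
        rw [hrew] at this
        exact Or.inr this
    · obtain ⟨j, hj, i, hi, hle⟩ := hc.first_ge
      rw [hrew] at hle
      exact ⟨j, hj, i, i.2, hi, hle⟩

theorem exists_valid (x : DFAOCode) : ∃ z : CertCode, z.Valid x := by
  have hden : ∀ q : Fin (x.2.1 + 1), x.den q ≠ 0 := fun q =>
    (lt_of_lt_of_le Nat.zero_lt_one (le_max_right _ _)).ne'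
  -- A factorial serves as the period: it is divisible by every number up to the number of states of
  -- the padded system.
  have hdvd : ∀ i, 1 ≤ i → i ≤ Fintype.card (Fin (x.2.1 + 1)) → i ∣ (x.2.1 + 1).factorial := by
    intro i hi hi'
    rw [Fintype.card_fin] at hi'
    exact Nat.dvd_factorial hi hi'
  obtain ⟨D, g, b, c, y, U, hD, hc⟩ := exists_isCertificate (le_max_right x.1 2) x.fstep
    (fun q => x.num q) (fun q => x.den q) (Fin.last x.2.1) hden (Nat.factorial_pos _) hdvd
  obtain ⟨lc, hlc⟩ := exists_entry_eq (x.2.1 + 1).factorial _ c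
  obtain ⟨ly, hly⟩ := exists_entry_eq (x.2.1 + 1).factorial _ y
  obtain ⟨lU, hlU⟩ := exists_entry_eq (x.2.1 + 1).factorial _ U
  refine ⟨(((x.2.1 + 1).factorial, D, g, b), (lc, ly, lU)), valid_iff.2
    ⟨⟨hD, (Nat.factorial_pos _).ne', hdvd⟩, ?_⟩⟩
  -- The encoded tables agree with the functions only for `j` up to the period; no condition looks
  -- further.
  have hc' : ∀ q : Fin (x.2.1 + 1), ∀ j ≤ (x.2.1 + 1).factorial,
    mean (((x.2.1 + 1).factorial, D, g, b), (lc, ly, lU)) q j = c q j := hlc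
  have hy' : ∀ q : Fin (x.2.1 + 1), ∀ j ≤ (x.2.1 + 1).factorial,
    cobd (((x.2.1 + 1).factorial, D, g, b), (lc, ly, lU)) q j = y q j := hly
  have hU' : ∀ q : Fin (x.2.1 + 1), ∀ j ≤ (x.2.1 + 1).factorial,
    value (((x.2.1 + 1).factorial, D, g, b), (lc, ly, lU)) q j = U q j := hlU
  simp only [period, denom, numer, shift]
  constructor
  · intro q j hj
    simp only [hc' _ _ hj.le, hc' q (j + 1) hj]
    exact hc.mean_step q j hj
  · intro q j hj
    simp only [hy' _ _ hj.le, hy' q (j + 1) hj]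
    exact hc.coboundary_step q j hj
  · intro q
    simp only [hc' _ _ le_rfl, hc' _ _ (Nat.zero_le _)]
    exact hc.mean_periodic q
  · intro q
    simp only [hU' _ _ le_rfl, hU' _ _ (Nat.zero_le _)]
    exact hc.value_periodic q
  · intro q
    simp only [hc' _ _ (Nat.zero_le _), hy' _ _ le_rfl, hy' _ _ (Nat.zero_le _)]
    exact hc.output_eq q
  · intro q j hj i
    simp only [hc' _ _ hj.le, hU' _ _ hj.le, hU' q (j + 1) hj]
    exact hc.bellman_le q j hj i
  · intro q j hj
    simp only [hc' _ _ hj.le, hU' _ _ hj.le, hU' q (j + 1) hj]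
    exact hc.bellman_eq q j hj
  · intro j hj i hi
    simp only [hc' _ _ hj.le, hU' _ _ hj.le]
    exact hc.first_le j hj i hi
  · obtain ⟨j, hj, h⟩ := hc.first_ge
    refine ⟨j, hj, ?_⟩
    simp only [hc' _ _ hj.le, hU' _ _ hj.le]
    exact h

/-! ### Computability of the certificate search -/

section Computability

variable {α : Type} [Primcodable α] {x : α → DFAOCode} {z : α → CertCode} {q i j : α → ℕ}

theorem primrec_period (hz : Primrec z) : Primrec fun t => (z t).period :=
  Primrec.fst.comp (Primrec.fst.comp hz)

theorem primrec_denom (hz : Primrec z) : Primrec fun t => (z t).denom :=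
  Primrec.fst.comp (Primrec.snd.comp (Primrec.fst.comp hz))

theorem primrec_numer (hz : Primrec z) : Primrec fun t => (z t).numer :=
  Primrec.fst.comp (Primrec.snd.comp (Primrec.snd.comp (Primrec.fst.comp hz)))

theorem primrec_shift (hz : Primrec z) : Primrec fun t => (z t).shift :=
  Primrec.snd.comp (Primrec.snd.comp (Primrec.snd.comp (Primrec.fst.comp hz)))

theorem primrec_entry {a : α → ℕ} {l : α → List ℕ} (ha : Primrec a) (hl : Primrec l)
    (hq : Primrec q) (hj : Primrec j) : Primrec fun t => entry (a t) (l t) (q t) (j t) :=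
  (Primrec.list_getD 0).comp hl
    (Primrec.nat_add.comp (Primrec.nat_mul.comp hq (Primrec.succ.comp ha)) hj)

theorem primrec_mean (hz : Primrec z) (hq : Primrec q) (hj : Primrec j) :
    Primrec fun t => (z t).mean (q t) (j t) :=
  primrec_entry (primrec_period hz) (Primrec.fst.comp (Primrec.snd.comp hz)) hq hj

theorem primrec_cobd (hz : Primrec z) (hq : Primrec q) (hj : Primrec j) :
    Primrec fun t => (z t).cobd (q t) (j t) :=
  primrec_entry (primrec_period hz) (Primrec.fst.comp (Primrec.snd.comp (Primrec.snd.comp hz))) hq hj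

theorem primrec_value (hz : Primrec z) (hq : Primrec q) (hj : Primrec j) :
    Primrec fun t => (z t).value (q t) (j t) :=
  primrec_entry (primrec_period hz) (Primrec.snd.comp (Primrec.snd.comp (Primrec.snd.comp hz))) hq hj

theorem primrec_reward (hx : Primrec x) (hz : Primrec z) (hq : Primrec q) (hj : Primrec j)
    (hi : Primrec i) : Primrec fun t => (z t).reward (x t) (q t) (j t) (i t) :=
  Primrec.nat_add.comp
    (Primrec.sum_range (g := fun t i' => (z t).mean ((x t).step (q t) i') (j t)) hi
      (primrec_mean (hz.comp Primrec.fst)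
        (DFAOCode.primrec_step (hx.comp Primrec.fst) (hq.comp Primrec.fst) Primrec.snd)
        (hj.comp Primrec.fst)))
    (primrec_value hz (DFAOCode.primrec_step hx hq hi) hj)

theorem primrec_bound (hx : Primrec x) (hz : Primrec z) (hq : Primrec q) (hj : Primrec j)
    (hi : Primrec i) : Primrec fun t =>
      (x t).base * (z t).value (q t) (j t + 1) + (z t).numer * i t + (z t).shift :=
  Primrec.nat_add.comp
    (Primrec.nat_add.comp
      (Primrec.nat_mul.comp (DFAOCode.primrec_base hx) (primrec_value hz hq (Primrec.succ.comp hj)))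
      (Primrec.nat_mul.comp (primrec_numer hz) hi))
    (primrec_shift hz)

theorem primrec_rewardShift (hx : Primrec x) (hz : Primrec z) (hq : Primrec q) (hj : Primrec j)
    (hi : Primrec i) : Primrec fun t =>
      (z t).reward (x t) (q t) (j t) (i t) + (x t).base * (z t).shift :=
  Primrec.nat_add.comp (primrec_reward hx hz hq hj hi)
    (Primrec.nat_mul.comp (DFAOCode.primrec_base hx) (primrec_shift hz))

theorem primrec_firstBound (hz : Primrec z) (hi : Primrec i) :
    Primrec fun t => (z t).numer * i t + (z t).shift :=
  Primrec.nat_add.comp (Primrec.nat_mul.comp (primrec_numer hz) hi) (primrec_shift hz)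

theorem primrecPred_step_eq {f : CertCode → ℕ → ℕ → ℕ}
    (hf : ∀ {β : Type} [Primcodable β] {z : β → CertCode} {q j : β → ℕ}, Primrec z → Primrec q →
      Primrec j → Primrec fun t => f (z t) (q t) (j t))
    (hx : Primrec x) (hz : Primrec z) (hq : Primrec q) (hj : Primrec j) :
    PrimrecPred fun t => (x t).base * f (z t) (q t) (j t + 1) =
      ∑ i ∈ Finset.range (x t).base, f (z t) ((x t).step (q t) i) (j t) :=
  Primrec.eq.comp
    (Primrec.nat_mul.comp (DFAOCode.primrec_base hx) (hf hz hq (Primrec.succ.comp hj)))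
    (Primrec.sum_range (g := fun t i => f (z t) ((x t).step (q t) i) (j t))
      (DFAOCode.primrec_base hx)
      (hf (hz.comp Primrec.fst)
        (DFAOCode.primrec_step (hx.comp Primrec.fst) (hq.comp Primrec.fst) Primrec.snd)
        (hj.comp Primrec.fst)))

theorem primrecPred_valid : PrimrecPred fun p : DFAOCode × CertCode => p.2.Valid p.1 := by
  have hx : Primrec fun p : DFAOCode × CertCode => p.1 := Primrec.fst
  have hz : Primrec fun p : DFAOCode × CertCode => p.2 := Primrec.snd
  have hst : Primrec fun p : DFAOCode × CertCode => p.1.2.1 := DFAOCode.primrec_states hx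
  refine PrimrecPred.and (PrimrecPred.and (PrimrecPred.and ?_ (PrimrecPred.and ?_ ?_)) ?_)
    (PrimrecPred.and ?_ (PrimrecPred.and ?_ ?_))
  · exact (Primrec.eq.comp (primrec_denom hz) (Primrec.const 0)).not
  · exact (Primrec.eq.comp (primrec_period hz) (Primrec.const 0)).not
  · exact PrimrecPred.forall_lt_of (Primrec.succ.comp hst)
      (Primrec.eq.comp (Primrec.nat_mod.comp (primrec_period (hz.comp Primrec.fst))
        (Primrec.succ.comp Primrec.snd)) (Primrec.const 0))
  · refine PrimrecPred.forall_lt_of (Primrec.succ.comp hst) ?_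
    have hz' := hz.comp (Primrec.fst (α := DFAOCode × CertCode) (β := ℕ))
    have hx' := hx.comp (Primrec.fst (α := DFAOCode × CertCode) (β := ℕ))
    have hq := Primrec.snd (α := DFAOCode × CertCode) (β := ℕ)
    have h0 := Primrec.const (α := (DFAOCode × CertCode) × ℕ) 0
    have ha := primrec_period hz'
    exact (Primrec.eq.comp (primrec_mean hz' hq ha) (primrec_mean hz' hq h0)).and
      ((Primrec.eq.comp (primrec_value hz' hq ha) (primrec_value hz' hq h0)).and
      (Primrec.eq.comp
        (Primrec.nat_add.comp (Primrec.nat_mul.comp (primrec_denom hz') (DFAOCode.primrec_num hx' hq))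
          (Primrec.nat_mul.comp (DFAOCode.primrec_den hx' hq) (primrec_cobd hz' hq h0)))
        (Primrec.nat_mul.comp (DFAOCode.primrec_den hx' hq)
          (Primrec.nat_add.comp (primrec_mean hz' hq h0) (primrec_cobd hz' hq ha)))))
  · refine PrimrecPred.forall_lt_of (Primrec.succ.comp hst)
      (PrimrecPred.forall_lt_of (primrec_period (hz.comp Primrec.fst)) ?_)
    have hfst := Primrec.fst.comp (Primrec.fst (α := (DFAOCode × CertCode) × ℕ) (β := ℕ))
    have hx' := hx.comp hfst
    have hz' := hz.comp hfst
    have hq := Primrec.snd.comp (Primrec.fst (α := (DFAOCode × CertCode) × ℕ) (β := ℕ))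
    have hj := Primrec.snd (α := (DFAOCode × CertCode) × ℕ) (β := ℕ)
    have hb := DFAOCode.primrec_base hx'
    have hf := Primrec.fst (α := ((DFAOCode × CertCode) × ℕ) × ℕ) (β := ℕ)
    have hs := Primrec.snd (α := ((DFAOCode × CertCode) × ℕ) × ℕ) (β := ℕ)
    have hl := primrec_rewardShift (hx'.comp hf) (hz'.comp hf) (hq.comp hf) (hj.comp hf) hs
    have hr := primrec_bound (hx'.comp hf) (hz'.comp hf) (hq.comp hf) (hj.comp hf) hs
    exact ((primrecPred_step_eq primrec_mean hx' hz' hq hj).and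
      (primrecPred_step_eq primrec_cobd hx' hz' hq hj)).and
      ((PrimrecPred.forall_lt_of hb (Primrec.nat_le.comp hl hr)).and
      (PrimrecPred.exists_lt_of hb (Primrec.eq.comp hl hr)))
  · refine PrimrecPred.forall_lt_of (primrec_period hz) (PrimrecPred.forall_lt_of
      (DFAOCode.primrec_base (hx.comp Primrec.fst)) ?_)
    have hfst := Primrec.fst.comp (Primrec.fst (α := (DFAOCode × CertCode) × ℕ) (β := ℕ))
    have hj := Primrec.snd.comp (Primrec.fst (α := (DFAOCode × CertCode) × ℕ) (β := ℕ))
    have hi := Primrec.snd (α := (DFAOCode × CertCode) × ℕ) (β := ℕ)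
    exact (Primrec.eq.comp hi (Primrec.const 0)).or (Primrec.nat_le.comp
      (primrec_reward (hx.comp hfst) (hz.comp hfst) (hst.comp hfst) hj hi)
      (primrec_firstBound (hz.comp hfst) hi))
  · refine PrimrecPred.exists_lt_of (primrec_period hz) (PrimrecPred.exists_lt_of
      (DFAOCode.primrec_base (hx.comp Primrec.fst)) ?_)
    have hfst := Primrec.fst.comp (Primrec.fst (α := (DFAOCode × CertCode) × ℕ) (β := ℕ))
    have hj := Primrec.snd.comp (Primrec.fst (α := (DFAOCode × CertCode) × ℕ) (β := ℕ))
    have hi := Primrec.snd (α := (DFAOCode × CertCode) × ℕ) (β := ℕ)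
    exact (Primrec.eq.comp hi (Primrec.const 0)).not.and (Primrec.nat_le.comp
      (primrec_firstBound (hz.comp hfst) hi)
      (primrec_reward (hx.comp hfst) (hz.comp hfst) (hst.comp hfst) hj hi))

/-- Searching for a certificate is an algorithm that terminates on all descriptions. -/
theorem exists_computable_valid :
    ∃ F : DFAOCode → CertCode, Computable F ∧ ∀ x, (F x).Valid x := by
  obtain ⟨chk, hchk, hiff⟩ : ∃ chk : DFAOCode × CertCode → Bool, Primrec chk ∧
      ∀ x z, chk (x, z) = true ↔ z.Valid x := by
    obtain ⟨hdec, hv⟩ := primrecPred_valid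
    exact ⟨_, hv, fun x z => decide_eq_true_iff⟩
  -- The number `n` is decoded and kept only if it is a valid certificate; `exists_valid` guarantees
  -- a success.
  let s : DFAOCode → ℕ → Option CertCode := fun x n =>
    (Encodable.decode (α := CertCode) n).bind fun z => cond (chk (x, z)) (some z) none
  have hs : Primrec₂ s :=
    Primrec.option_bind (Primrec.decode.comp Primrec.snd)
      (Primrec.cond (hchk.comp ((Primrec.fst.comp Primrec.fst).pair Primrec.snd))
        (Primrec.option_some.comp Primrec.snd) (Primrec.const none))
  have hval : ∀ {x n z}, z ∈ s x n → z.Valid x := by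
    intro x n z hz
    obtain ⟨z', -, hz'⟩ := Option.bind_eq_some_iff.1 hz
    cases h : chk (x, z') with
    | false => simp [h] at hz'
    | true =>
      rw [h] at hz'
      obtain rfl := Option.some.inj hz'
      exact (hiff _ _).1 h
  have hdom : ∀ x, (Nat.rfindOpt (s x)).Dom := by
    intro x
    obtain ⟨z, hz⟩ := exists_valid x
    refine Nat.rfindOpt_dom.2 ⟨Encodable.encode z, z, ?_⟩
    exact Option.bind_eq_some_iff.2 ⟨z, Encodable.encodek z, by rw [(hiff x z).2 hz, cond_true]⟩
  refine ⟨fun x => (Nat.rfindOpt (s x)).get (hdom x), ?_, fun x => ?_⟩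
  · exact (Partrec.rfindOpt hs.to_comp).of_eq_tot fun x => Part.get_mem (hdom x)
  · obtain ⟨n, hn⟩ := Nat.rfindOpt_spec (Part.get_mem (hdom x))
    exact hval hn

end Computability

end CertCode

/-! ### Correctness for descriptions of actual automata -/

section Correctness

variable {k m : ℕ} {Γ : DFAO (Fin k) (Fin m) ℚ≥0}

theorem DFAO.base_code (hk : 2 ≤ k) : Γ.code.base = k := max_eq_left hk

/-- The number of a state of the padded automaton. -/
def stateIndex : Option (Fin m) → ℕ
  | none => m
  | some q => q

theorem DFAO.step_code (q : Option (Fin m)) (i : Fin k) :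
    Γ.code.step (stateIndex q) i = stateIndex (Γ.paddedStep q i) := by
  have hrow : ∀ q : Fin m, (Γ.code.2.2.2.1.getD q []).getD i 0 = Γ.step q i := by
    intro q
    simp [DFAO.code]
  have hm : Γ.code.2.1 = m := rfl
  have hs : Γ.code.2.2.1 = Γ.start := rfl
  rcases q with _ | q
  · simp only [stateIndex, DFAO.paddedStep, DFAOCode.step, hm, hs, true_and, if_true, hrow]
    split_ifs with hi
    · rfl
    · exact min_eq_left (Fin.is_lt _).le
  · have hq : (q : ℕ) ≠ m := q.2.ne
    simp only [stateIndex, DFAO.paddedStep, DFAOCode.step, hm, hq, false_and, if_false, hrow]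
    exact min_eq_left (Fin.is_lt _).le

theorem DFAO.outPair_code (q : Option (Fin m)) :
    Γ.code.outPair (stateIndex q) = ((Γ.paddedOut q).num, (Γ.paddedOut q).den) := by
  have hrow : ∀ q : Fin m, Γ.code.2.2.2.2.getD q (0, 0) = ((Γ.out q).num, (Γ.out q).den) := by
    intro q
    simp [DFAO.code]
  have hm : Γ.code.2.1 = m := rfl
  have hs : Γ.code.2.2.1 = Γ.start := rfl
  rcases q with _ | q
  · simp only [stateIndex, DFAO.paddedOut, DFAOCode.outPair, hm, hs, if_true, hrow]
  · have hq : (q : ℕ) ≠ m := q.2.ne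
    simp only [stateIndex, DFAO.paddedOut, DFAOCode.outPair, hm, hq, if_false, hrow]

theorem wordVal_map_cast {k k' : ℕ} (hk : k = k') (w : List (Fin k)) :
    wordVal (w.map (Fin.cast hk)) = wordVal w := by
  subst hk
  simp

/-- A valid certificate for the description of an automaton determines the upper mean. -/
theorem CertCode.Valid.upperMean_eq (hk : 2 ≤ k) {h : ℕ → ℚ≥0} (hΓ : Γ.Generates hk h) {z : CertCode}
    (hz : z.Valid Γ.code) : z.denom ≠ 0 ∧ upperMean h = (z.numer : ℝ) / z.denom := by
  obtain ⟨⟨hD, ha, hd⟩, hc⟩ := CertCode.valid_iff.1 hz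
  refine ⟨hD, hc.upperMean_eq (show 2 ≤ Γ.code.base from le_max_right _ _) (Nat.pos_of_ne_zero ha) hd hD
    (fun q => (lt_of_lt_of_le Nat.zero_lt_one (le_max_right _ _)).ne') ?_⟩
  -- The base `max k 2` equals `k` but not by definition, so letters are transported along this
  -- equality.
  have hb : Γ.code.base = k := DFAO.base_code hk
  have hfold : ∀ w : List (Fin Γ.code.base), ((w.foldl Γ.code.fstep (Fin.last _)).val : ℕ) =
      stateIndex ((w.map (Fin.cast hb)).foldl Γ.paddedStep none) := by
    intro w
    induction w using List.reverseRecOn with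
    | nil => rfl
    | append_singleton w i ih =>
      rw [List.foldl_append, List.map_append, List.foldl_append, List.foldl_cons, List.foldl_nil,
        List.map_cons, List.map_nil, List.foldl_cons, List.foldl_nil, ← DFAO.step_code, ← ih]
      rfl
  intro w
  rw [← wordVal_map_cast hb, hΓ.paddedOut_foldl]
  simp only [DFAOCode.num, hfold, DFAO.outPair_code]
  rw [max_eq_left (NNRat.den_pos _)]
  conv_lhs => rw [← NNRat.num_div_den (Γ.paddedOut _)]
  push_cast
  rfl

end Correctness

/-! ### The theorem -/

theorem theorem1p1 :
    (∀ (k : ℕ) (hk : 2 ≤ k) (h : ℕ → ℚ≥0), IsAutomatic hk h →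
      (leftKernel k h).Finite ∧
      (∃ c : (List (Fin k) → ℚ≥0) → ℕ → ℚ,
        IsMeanSystem k h ((Finset.Icc 1 (leftKernel k h).ncard).lcm id) c) ∧
      ∃ γ : ℚ, upperMean h = (γ : ℝ) ∧
        ∀ (a : ℕ) (c : (List (Fin k) → ℚ≥0) → ℕ → ℚ), 1 ≤ a → IsMeanSystem k h a c →
          (pumpValues k h a c).Finite ∧ IsGreatest (pumpValues k h a c) γ) ∧
    ∃ F : DFAOCode → ℕ × ℕ, Computable F ∧
      ∀ (k : ℕ) (hk : 2 ≤ k) (m : ℕ) (Γ : DFAO (Fin k) (Fin m) ℚ≥0) (h : ℕ → ℚ≥0),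
        Γ.Generates hk h →
          (F Γ.code).2 ≠ 0 ∧ upperMean h = ((F Γ.code).1 : ℝ) / ((F Γ.code).2 : ℝ) := by
  refine ⟨fun k hk h hh => ?_, ?_⟩
  · have hfin := finite_leftKernel hk hh
    have ha0 : 0 < (Finset.Icc 1 (leftKernel k h).ncard).lcm id := by
      refine Nat.pos_of_ne_zero fun h0 => ?_
      obtain ⟨x, hx, hx0⟩ := Finset.lcm_eq_zero_iff.1 h0
      simp only [id] at hx0
      have := (Finset.mem_Icc.1 hx).1
      omega
    have hc := exists_isMeanSystem (h := h) (by omega : 0 < k) hfin ha0 fun i hi hi' =>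
      Finset.dvd_lcm (f := id) (Finset.mem_Icc.2 ⟨hi, hi'⟩)
    refine ⟨hfin, hc, ?_⟩
    obtain ⟨c, hc⟩ := hc
    obtain ⟨γ, -, hγ⟩ := hc.exists_isGreatest hk hfin ha0
    refine ⟨γ, hγ, fun a c' ha hc' => ⟨finite_pumpValues, ?_⟩⟩
    obtain ⟨γ', hγ', he⟩ := hc'.exists_isGreatest hk hfin ha
    -- Both maxima equal the upper mean, so the maximum does not depend on `a` or on the mean
    -- system.
    have : γ = γ' := by
      rw [hγ] at he
      exact_mod_cast he
    rwa [this]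
  · obtain ⟨F, hF, hv⟩ := CertCode.exists_computable_valid
    refine ⟨fun x => ((F x).numer, (F x).denom), ?_, fun k hk m Γ h hΓ => (hv Γ.code).upperMean_eq hk hΓ⟩
    exact ((CertCode.primrec_numer Primrec.id).pair (CertCode.primrec_denom Primrec.id)).to_comp.comp hF
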